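/- Work over $\mathbb{Q}$. For a composition $\alpha=(a_1,\dots,a_k)$ of $n\ge 0$ let $S_\alpha=\{a_1,a_1+a_2,\dots,a_1+\cdots+a_{k-1}\}\subseteq[n-1]$, let $M_\alpha=\sum_{i_1<\cdots<i_k}x_{i_1}^{a_1}\cdots x_{i_k}^{a_k}$ be the monomial quasisymmetric function, and let $F_\alpha=\sum_{S_\beta\supseteq S_\alpha}M_\beta$ (sum over compositions $\beta$ of $n$) be the fundamental quasisymmetric function. Let $\mathcal{Q}=\bigoplus_n\mathcal{Q}_n$ be the graded Hopf algebra of quasisymmetric functions, with the multiplication of power series and the coproduct $\Delta(M_\alpha)=\sum_{\alpha=\beta\cdot\gamma}M_\beta\otimes M_\gamma$ (sum over all ways to write $\alpha$ as a concatenation of two possibly empty compositions); $\mathrm{End}(\mathcal{Q})$ is the set of its graded Hopf algebra endomorphisms. Let $(n)$ denote the composition of $n$ with one part (the empty composition if $n=0$). For $\sigma\in\mathfrak{S}_n$ let $D(\sigma)$ be the composition of $n$ with $S_{D(\sigma)}=\{i\in[n-1]:\sigma_i>\sigma_{i+1}\}$. Let $\Phi\in\mathrm{End}(\mathcal{Q})$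 and $n\ge 0$. Define $c_{\alpha,\beta}$ by $\Phi(F_\alpha)=\sum_\beta c_{\alpha,\beta}F_\beta$ for compositions $\alpha,\beta$ of $n$, write $c_{\alpha,n}=c_{\alpha,(n)}$, and define $\lambda$ by $\Phi(M_{(1)})=\lambda M_{(1)}$. Where the denominator is nonzero put $\mathrm{Prob}_\Phi(\pi)=c_{D(\pi),n}/\sum_{\sigma\in\mathfrak{S}_n}c_{D(\sigma),n}$ for $\pi\in\mathfrak{S}_n$, and let $K$ be the matrix on $\mathfrak{S}_n$ with $K(\pi,\sigma\pi)=\mathrm{Prob}_\Phi(\sigma^{-1})$. Say that $\Phi_n=\Phi|_{\mathcal{Q}_n}$ has the partitioning property if there is an equivalence relation on the compositions of $n$, with set of classes $E$ and with $\widehat\alpha$ the class of $\alpha$, such that $\Phi(F_\alpha)$ depends only on $\widehat\alpha$ and the elements $\phi_{\widehat\alpha}=\Phi(F_\alpha)$, $\widehat\alpha\in E$, form a basis of $\Phi(\mathcal{Q}_n)$. In that case define $d_{a,b}$ by $\Phi(\phi_a)=\sum_{b\in E}d_{a,b}\,\phi_b$ for $a,b\in E$ and, if $\lambda^n\ne0$,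 put $\widehat K(a,b)=\lambda^{-n}d_{a,b}$. **Theorem.** (i) Suppose that $\Phi_n$ has the partitioning property and that the numbers $c_{\alpha,n}$, for $\alpha$ a composition of $n$, are nonnegative and not all zero. Then $\lambda^n>0$, $K$ and $\widehat K$ are (row-)stochastic matrices, and $\widehat K$ lumps $K$ by the equivalence classes: for every $b\in E$ the sum $\sum_{\sigma:\,\widehat{D(\sigma)}=b}K(\pi,\sigma)$ depends only on $\widehat{D(\pi)}$, and it equals $\widehat K(\widehat{D(\pi)},b)$. (ii) For a composition $\alpha$ put $\Lambda(\alpha)=\{i\in S_\alpha: i\ne 1,\ i-1\notin S_\alpha\}$, so that $\Lambda(\pi):=\Lambda(D(\pi))=\{i\in\{2,\dots,n-1\}:\pi_{i-1}<\pi_i>\pi_{i+1}\}$ is the peak set of $\pi\in\mathfrak{S}_n$. There is $\Theta\in\mathrm{End}(\mathcal{Q})$ (Stembridge's map) with $$\Theta(F_\alpha)=2^{|\Lambda(\alpha)|+1}\sum_{\beta:\ \Lambda(\alpha)\subseteq S_\beta\triangle(S_\beta+1)}F_\beta$$ for all compositions $\alpha$ of all $n\ge1$ (sum over compositions $\beta$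 of $n$). For every $n\ge1$ it satisfies the hypotheses of (i), with $\alpha\sim\beta$ if and only if $\Lambda(\alpha)=\Lambda(\beta)$. Moreover $\mathrm{Prob}_\Theta(\pi)=2^{-(n-1)}$ if the peak set of $\pi$ is empty and $\mathrm{Prob}_\Theta(\pi)=0$ otherwise. Hence $\widehat K$ is stochastic, it lumps $K$ by peak sets, and it is the transition matrix of the random walk on peak sets in which the peak set of $\pi$ steps to the peak set of $\sigma^{-1}\pi$ with probability $\mathrm{Prob}_\Theta(\sigma)$: for all $\pi,\tau\in\mathfrak{S}_n$, $$\widehat K\big(\widehat{D(\pi)},\widehat{D(\tau)}\big)=\sum_{\sigma\in\mathfrak{S}_n:\ \Lambda(\sigma^{-1}\pi)=\Lambda(\tau)}\mathrm{Prob}_\Theta(\sigma).$$ -/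

import Mathlib

open scoped TensorProduct

noncomputable section

namespace QS

/-! ### Quasisymmetric functions -/

/-- The sequence of nonzero exponents of the monomial `x ^ m`, read in increasing order of the
variables: the monomial is `x_{i₁} ^ a₁ ⋯ x_{iₖ} ^ aₖ` with `i₁ < ⋯ < iₖ` and
`expList m = [a₁, …, aₖ]`, all `aⱼ > 0`. -/
def expList (m : ℕ →₀ ℕ) : List ℕ := m.support.sort.map m

/-- The formal power series `∑_{i₁ < ⋯ < iₖ} x_{i₁} ^ a₁ ⋯ x_{iₖ} ^ aₖ`, where
`L = [a₁, …, aₖ]` is a list of positive integers, given by its coefficients. -/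
def monoSeries (L : List ℕ) : MvPowerSeries ℕ ℚ := fun m => if expList m = L then 1 else 0

lemma coeff_monoSeries (L : List ℕ) (m : ℕ →₀ ℕ) :
    MvPowerSeries.coeff m (monoSeries L) = if expList m = L then 1 else 0 := rfl

/-- The linear span of all monomial quasisymmetric functions. -/
def qsymSpan : Submodule ℚ (MvPowerSeries ℕ ℚ) :=
  Submodule.span ℚ (Set.range fun α : Σ n, Composition n => monoSeries α.2.blocks)

lemma expList_pos {m : ℕ →₀ ℕ} {a : ℕ} (h : a ∈ expList m) : 0 < a := by
  simp only [expList, List.mem_map, Finset.mem_sort, Finsupp.mem_support_iff] at h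
  obtain ⟨i, hi, rfl⟩ := h
  omega

lemma expList_sum (m : ℕ →₀ ℕ) : (expList m).sum = m.degree := by
  have h : (↑(m.support.sort.map m) : Multiset ℕ) = m.support.1.map m := by
    rw [← Multiset.map_coe, Finset.sort_eq]
  rw [expList, ← Multiset.sum_coe, h]
  rfl

lemma expList_embDomain (e : ℕ ↪o ℕ) (m : ℕ →₀ ℕ) :
    expList (m.embDomain e.toEmbedding) = expList m := by
  have h : (m.support.map e.toEmbedding).sort = m.support.sort.map e :=
    ((Finset.map_sort e.toEmbedding m.support (· ≤ ·) (· ≤ ·)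
      (fun a _ b _ => (e.le_iff_le).symm))).symm
  unfold expList
  rw [Finsupp.support_embDomain, h, List.map_map]
  refine List.map_congr_left fun i _ => ?_
  exact Finsupp.embDomain_apply_self e.toEmbedding m i

lemma support_toFinsupp {L : List ℕ} (hL : ∀ a ∈ L, 0 < a) :
    L.toFinsupp.support = Finset.range L.length := by
  ext i
  simp only [Finsupp.mem_support_iff, Finset.mem_range]
  constructor
  · intro h
    by_contra h'
    exact h (List.toFinsupp_apply_le _ _ (not_lt.mp h'))
  · intro h
    rw [List.toFinsupp_apply_lt _ _ h]
    exact (hL _ (List.getElem_mem h)).ne'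

lemma expList_toFinsupp {L : List ℕ} (hL : ∀ a ∈ L, 0 < a) : expList L.toFinsupp = L := by
  unfold expList
  rw [support_toFinsupp hL, Finset.sort_range]
  refine List.ext_getElem (by simp) fun i h1 h2 => ?_
  simp [h2]

lemma exists_embDomain (m : ℕ →₀ ℕ) :
    ∃ e : ℕ ↪o ℕ, m = (expList m).toFinsupp.embDomain e.toEmbedding := by
  classical
  obtain ⟨N, hN⟩ : ∃ N, ∀ i ∈ m.support, i < N :=
    ⟨m.support.sup id + 1, fun i hi => Nat.lt_succ_of_le (Finset.le_sup (f := id) hi)⟩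
  set p : ℕ → Prop := fun i => i ∈ m.support ∨ N ≤ i with hp
  have hinf : (Set.ofPred p).Infinite :=
    (Set.Ici_infinite N).mono fun i hi => Or.inr hi
  set e : ℕ ↪o ℕ := OrderEmbedding.ofStrictMono (Nat.nth p) (Nat.nth_strictMono hinf) with he
  have hrange : Set.range e = Set.ofPred p := Nat.range_nth_of_infinite hinf
  have hsub : (↑m.support : Set ℕ) ⊆ Set.range e.toEmbedding := by
    intro i hi
    have : i ∈ Set.range e := by rw [hrange]; exact Or.inl hi
    exact this
  set m₀ : ℕ →₀ ℕ := m.comapDomain e.toEmbedding e.toEmbedding.injective.injOn with hm₀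
  have hm : m₀.embDomain e.toEmbedding = m := Finsupp.embDomain_comapDomain hsub
  have hexp : expList m = expList m₀ := by rw [← hm, expList_embDomain]
  have hmem : ∀ i, i ∈ m₀.support ↔ e i ∈ m.support := by
    intro i
    simp [hm₀]
  have hinit : ∀ i ∈ m₀.support, ∀ j < i, j ∈ m₀.support := by
    intro i hi j hji
    rw [hmem] at hi ⊢
    have h1 : p (e j) := by
      have : e j ∈ Set.range e := ⟨j, rfl⟩
      rw [hrange] at this
      exact this
    rcases h1 with h1 | h1
    · exact h1
    · have := hN _ hi
      have := e.strictMono hji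
      omega
  obtain ⟨k, hk⟩ : ∃ k, m₀.support = Finset.range k := by
    refine ⟨m₀.support.card, ?_⟩
    symm
    refine Finset.eq_of_subset_of_card_le ?_ (by simp)
    intro i hi
    by_contra hni
    have : m₀.support ⊆ Finset.range i := by
      intro j hj
      rw [Finset.mem_range]
      by_contra hji
      rcases (not_lt.mp hji).lt_or_eq with h | h
      · exact hni (hinit j hj i h)
      · exact hni (h ▸ hj)
    have := Finset.card_le_card this
    simp at this hi
    omega
  refine ⟨e, ?_⟩
  have h0 : (expList m).toFinsupp = m₀ := by
    rw [hexp]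
    ext i
    have hl : (expList m₀).length = k := by simp [expList, hk]
    by_cases hi : i < k
    · rw [List.toFinsupp_apply_lt _ _ (by omega)]
      simp [expList, hk]
    · rw [List.toFinsupp_apply_le _ _ (by omega)]
      have : i ∉ m₀.support := by rw [hk]; simpa using hi
      exact (Finsupp.notMem_support_iff.mp this).symm
  rw [h0, hm]

/-- Membership in the span of the monomial quasisymmetric functions: the coefficient of a monomial
depends only on its sequence of exponents, and the degree is bounded. -/
lemma mem_qsymSpan_iff (f : MvPowerSeries ℕ ℚ) :
    f ∈ qsymSpan ↔
      (∀ m m', expList m = expList m' → MvPowerSeries.coeff m f = MvPowerSeries.coeff m' f) ∧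
      ∃ N : ℕ, ∀ m : ℕ →₀ ℕ, N < m.degree → MvPowerSeries.coeff m f = 0 := by
  constructor
  · intro hf
    induction hf using Submodule.span_induction with
    | mem x hx =>
      obtain ⟨⟨n, α⟩, rfl⟩ := hx
      refine ⟨fun m m' h => ?_, n, fun m hm => ?_⟩
      · rw [coeff_monoSeries, coeff_monoSeries, h]
      · rw [coeff_monoSeries, if_neg]
        intro h
        have h2 := expList_sum m
        have h3 : (expList m).sum = n := by rw [h]; exact α.blocks_sum
        omega
    | zero => exact ⟨fun _ _ _ => by simp, 0, fun _ _ => by simp⟩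
    | add x y _ _ hx hy =>
      obtain ⟨h1, N1, h1'⟩ := hx
      obtain ⟨h2, N2, h2'⟩ := hy
      refine ⟨fun m m' h => by rw [map_add, map_add, h1 m m' h, h2 m m' h], max N1 N2,
        fun m hm => ?_⟩
      rw [map_add, h1' m (lt_of_le_of_lt (le_max_left _ _) hm),
        h2' m (lt_of_le_of_lt (le_max_right _ _) hm), add_zero]
    | smul a x _ hx =>
      obtain ⟨h1, N1, h1'⟩ := hx
      refine ⟨fun m m' h => ?_, N1, fun m hm => ?_⟩
      · rw [MvPowerSeries.coeff_smul, MvPowerSeries.coeff_smul, h1 m m' h]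
      · rw [MvPowerSeries.coeff_smul, h1' m hm, mul_zero]
  · rintro ⟨h1, N, h2⟩
    have key : f = ∑ n ∈ Finset.range (N + 1), ∑ α : Composition n,
        (MvPowerSeries.coeff α.blocks.toFinsupp f) • monoSeries α.blocks := by
      ext m
      simp only [map_sum, MvPowerSeries.coeff_smul, coeff_monoSeries, mul_ite, mul_one, mul_zero]
      by_cases hm : N < m.degree
      · rw [h2 m hm, Finset.sum_eq_zero]
        intro n hn
        refine Finset.sum_eq_zero fun α _ => if_neg fun h => ?_
        have h3 := expList_sum m
        rw [h, α.blocks_sum] at h3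
        have := Finset.mem_range.mp hn
        omega
      · rw [Finset.sum_eq_single m.degree]
        · rw [Finset.sum_eq_single
            (⟨expList m, fun h => expList_pos h, expList_sum m⟩ : Composition m.degree)]
          · rw [if_pos rfl]
            refine h1 _ _ ?_
            rw [expList_toFinsupp fun _ => expList_pos]
          · intro α _ hα
            exact if_neg fun h => hα (Composition.ext h.symm)
          · intro h
            exact absurd (Finset.mem_univ _) h
        · intro n _ hn
          refine Finset.sum_eq_zero fun α _ => if_neg fun h => hn ?_
          rw [← expList_sum m, h, α.blocks_sum]
        · intro h
          exact absurd (Finset.mem_range.mpr (by omega)) h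
    rw [key]
    exact Submodule.sum_mem _ fun n _ => Submodule.sum_mem _ fun α _ =>
      Submodule.smul_mem _ _ (Submodule.subset_span ⟨⟨n, α⟩, rfl⟩)

lemma coeff_mul_embDomain (e : ℕ ↪o ℕ) (m : ℕ →₀ ℕ) {f g : MvPowerSeries ℕ ℚ}
    (hf : f ∈ qsymSpan) (hg : g ∈ qsymSpan) :
    MvPowerSeries.coeff (m.embDomain e.toEmbedding) (f * g) = MvPowerSeries.coeff m (f * g) := by
  classical
  rw [MvPowerSeries.coeff_mul, MvPowerSeries.coeff_mul,
    ← Finsupp.image_prodMap_embDomain_antidiagonal, Finset.sum_image]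
  · refine Finset.sum_congr rfl fun p _ => ?_
    rw [Prod.map_fst, Prod.map_snd,
      ((mem_qsymSpan_iff f).mp hf).1 _ p.1 (expList_embDomain e _),
      ((mem_qsymSpan_iff g).mp hg).1 _ p.2 (expList_embDomain e _)]
  · exact (Function.Injective.prodMap (Finsupp.embDomain_injective _)
      (Finsupp.embDomain_injective _)).injOn

lemma mul_mem_qsymSpan {f g : MvPowerSeries ℕ ℚ} (hf : f ∈ qsymSpan) (hg : g ∈ qsymSpan) :
    f * g ∈ qsymSpan := by
  classical
  rw [mem_qsymSpan_iff]
  constructor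
  · intro m m' h
    obtain ⟨e, he⟩ := exists_embDomain m
    obtain ⟨e', he'⟩ := exists_embDomain m'
    rw [he, he', coeff_mul_embDomain e _ hf hg, coeff_mul_embDomain e' _ hf hg, h]
  · obtain ⟨N1, h1⟩ := ((mem_qsymSpan_iff f).mp hf).2
    obtain ⟨N2, h2⟩ := ((mem_qsymSpan_iff g).mp hg).2
    refine ⟨N1 + N2, fun m hm => ?_⟩
    rw [MvPowerSeries.coeff_mul]
    refine Finset.sum_eq_zero fun p hp => ?_
    have hd : p.1.degree + p.2.degree = m.degree := by
      rw [← map_add, Finset.HasAntidiagonal.mem_antidiagonal.mp hp]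
    by_cases h : N1 < p.1.degree
    · rw [h1 _ h, zero_mul]
    · rw [h2 _ (by omega), mul_zero]

lemma one_mem_qsymSpan : (1 : MvPowerSeries ℕ ℚ) ∈ qsymSpan := by
  classical
  have : (1 : MvPowerSeries ℕ ℚ) = monoSeries (Composition.ones 0).blocks := by
    ext m
    rw [coeff_monoSeries, MvPowerSeries.coeff_one]
    refine if_congr ?_ rfl rfl
    rw [expList, Composition.ones_blocks, List.replicate_zero, List.map_eq_nil_iff,
      ← List.length_eq_zero_iff, Finset.length_sort, Finset.card_eq_zero, Finsupp.support_eq_empty]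
  rw [this]
  exact Submodule.subset_span ⟨⟨0, _⟩, rfl⟩

/-- The algebra of quasisymmetric functions over `ℚ` in the variables `x₀, x₁, x₂, …`: all linear
combinations of monomial quasisymmetric functions, with the multiplication of power series. -/
def QSym : Subalgebra ℚ (MvPowerSeries ℕ ℚ) :=
  qsymSpan.toSubalgebra one_mem_qsymSpan fun _ _ hf hg => mul_mem_qsymSpan hf hg

/-- The monomial quasisymmetric function indexed by a composition of `n`. -/
def M {n : ℕ} (α : Composition n) : QSym :=
  ⟨monoSeries α.blocks, Submodule.subset_span ⟨⟨n, α⟩, rfl⟩⟩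

lemma linearIndependent_M :
    LinearIndependent ℚ (fun α : Σ n, Composition n => M α.2) := by
  refine LinearIndependent.of_pairwise_dual_eq_zero_one _
    (fun α => (MvPowerSeries.coeff α.2.blocks.toFinsupp).comp QSym.val.toLinearMap) ?_ ?_
  · intro α β hαβ
    change MvPowerSeries.coeff α.2.blocks.toFinsupp (monoSeries β.2.blocks) = 0
    rw [coeff_monoSeries, expList_toFinsupp fun _ => α.2.blocks_pos, if_neg]
    exact fun h => hαβ (Composition.sigma_eq_iff_blocks_eq.mpr h)
  · intro α
    change MvPowerSeries.coeff α.2.blocks.toFinsupp (monoSeries α.2.blocks) = 1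
    rw [coeff_monoSeries, expList_toFinsupp fun _ => α.2.blocks_pos, if_pos rfl]

/-- The basis of monomial quasisymmetric functions. -/
def mBasis : Module.Basis (Σ n, Composition n) ℚ QSym :=
  Module.Basis.mk linearIndependent_M (by
    rintro ⟨f, hf⟩ -
    have hf' : f ∈ qsymSpan := hf
    induction hf' using Submodule.span_induction with
    | mem x hx =>
      obtain ⟨α, rfl⟩ := hx
      exact Submodule.subset_span ⟨α, rfl⟩
    | zero => exact Submodule.zero_mem _
    | add x y hx hy ihx ihy => exact Submodule.add_mem _ (ihx hx) (ihy hy)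
    | smul a x hx ih => exact Submodule.smul_mem _ a (ih hx))

lemma mBasis_apply (α : Σ n, Composition n) : mBasis α = M α.2 := by
  simp [mBasis]

/-- The composition of `a₁ + ⋯ + aₖ` formed by the first `i` parts of `α`. -/
def takeComp {n : ℕ} (α : Composition n) (i : ℕ) : Composition (α.blocks.take i).sum :=
  ⟨α.blocks.take i, fun h => α.blocks_pos (List.mem_of_mem_take h), rfl⟩

/-- The composition formed by the parts of `α` after the first `i`. -/
def dropComp {n : ℕ} (α : Composition n) (i : ℕ) : Composition (α.blocks.drop i).sum :=
  ⟨α.blocks.drop i, fun h => α.blocks_pos (List.mem_of_mem_drop h), rfl⟩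

/-- The coproduct of quasisymmetric functions: `Δ(M_α) = ∑_{α = β · γ} M_β ⊗ M_γ`, summed over all
ways to cut `α` into two possibly empty consecutive pieces. -/
def comul : QSym →ₗ[ℚ] QSym ⊗[ℚ] QSym :=
  mBasis.constr ℚ fun α =>
    ∑ i ∈ Finset.range (α.2.length + 1), M (takeComp α.2 i) ⊗ₜ[ℚ] M (dropComp α.2 i)

lemma comul_M {n : ℕ} (α : Composition n) :
    comul (M α) =
      ∑ i ∈ Finset.range (α.length + 1), M (takeComp α i) ⊗ₜ[ℚ] M (dropComp α i) := by
  have h := mBasis.constr_basis ℚ (fun α : Σ n, Composition n =>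
    ∑ i ∈ Finset.range (α.2.length + 1), M (takeComp α.2 i) ⊗ₜ[ℚ] M (dropComp α.2 i)) ⟨n, α⟩
  rwa [mBasis_apply] at h

/-- The counit of quasisymmetric functions: the constant coefficient. -/
def counit : QSym →ₗ[ℚ] ℚ :=
  (MvPowerSeries.coeff (0 : ℕ →₀ ℕ)).comp QSym.val.toLinearMap

/-- The homogeneous component of degree `n`: the span of the `M_α` with `α` a composition of
`n`. -/
def QSymDeg (n : ℕ) : Submodule ℚ QSym :=
  Submodule.span ℚ (Set.range (M : Composition n → QSym))

/-- Endomorphisms of the graded Hopf algebra of quasisymmetric functions. (A bialgebra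
homomorphism between Hopf algebras automatically commutes with the antipodes.) -/
structure QSymEnd extends QSym →ₐ[ℚ] QSym where
  map_comul : ∀ f, comul (toAlgHom f) =
    TensorProduct.map toAlgHom.toLinearMap toAlgHom.toLinearMap (comul f)
  map_counit : ∀ f, counit (toAlgHom f) = counit f
  map_deg : ∀ (n : ℕ), ∀ f ∈ QSymDeg n, toAlgHom f ∈ QSymDeg n

/-- The underlying linear operator of an endomorphism. -/
def QSymEnd.lin (Φ : QSymEnd) : QSym →ₗ[ℚ] QSym := Φ.toAlgHom.toLinearMap

/-! ### The fundamental basis -/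

/-- The set `S_α ⊆ {1, …, n - 1}` of proper partial sums `a₁, a₁ + a₂, …` of `α`. -/
def partialSums {n : ℕ} (α : Composition n) : Finset ℕ :=
  (α.boundaries.image fun j : Fin (n + 1) => (j : ℕ)) \ {0, n}

/-- The composition `co(T)` of `n` with set of proper partial sums `T ∩ {1, …, n - 1}`. -/
def co (n : ℕ) (T : Finset ℕ) : Composition n :=
  (compositionEquiv n).symm
    { boundaries := Finset.univ.filter fun j : Fin (n + 1) =>
        j = 0 ∨ j = Fin.last n ∨ (j : ℕ) ∈ T
      zero_mem := by simp
      getLast_mem := by simp }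

lemma co_boundaries (n : ℕ) (T : Finset ℕ) :
    (co n T).boundaries = Finset.univ.filter fun j : Fin (n + 1) =>
      j = 0 ∨ j = Fin.last n ∨ (j : ℕ) ∈ T := by
  unfold co
  exact CompositionAsSet.toComposition_boundaries _

lemma partialSums_co {n : ℕ} {T : Finset ℕ} (hT : ∀ i ∈ T, 0 < i ∧ i < n) :
    partialSums (co n T) = T := by
  ext i
  simp only [partialSums, co_boundaries, Finset.mem_sdiff, Finset.mem_image, Finset.mem_filter,
    Finset.mem_univ, true_and, Finset.mem_insert, Finset.mem_singleton, not_or]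
  constructor
  · rintro ⟨⟨j, hj, rfl⟩, h0, hn⟩
    rcases hj with rfl | rfl | hj
    · exact absurd rfl h0
    · exact absurd rfl hn
    · exact hj
  · intro hi
    obtain ⟨h1, h2⟩ := hT i hi
    exact ⟨⟨⟨i, by omega⟩, Or.inr (Or.inr hi), rfl⟩, by omega, by omega⟩

lemma co_partialSums {n : ℕ} (α : Composition n) : co n (partialSums α) = α := by
  apply (compositionEquiv n).injective
  apply CompositionAsSet.ext
  change (co n (partialSums α)).boundaries = α.boundaries
  rw [co_boundaries]
  ext j
  have h0 : (0 : Fin (n + 1)) ∈ α.boundaries := α.toCompositionAsSet.zero_mem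
  have hl : Fin.last n ∈ α.boundaries := α.toCompositionAsSet.getLast_mem
  simp only [partialSums, Finset.mem_filter, Finset.mem_univ, true_and, Finset.mem_sdiff,
    Finset.mem_image, Finset.mem_insert, Finset.mem_singleton, not_or]
  constructor
  · rintro (rfl | rfl | ⟨⟨i, hi, hij⟩, -⟩)
    · exact h0
    · exact hl
    · rwa [← Fin.ext hij]
  · intro hj
    by_cases h1 : j = 0
    · exact Or.inl h1
    by_cases h2 : j = Fin.last n
    · exact Or.inr (Or.inl h2)
    refine Or.inr (Or.inr ⟨⟨j, hj, rfl⟩, fun h => h1 (Fin.ext h), fun h => h2 (Fin.ext h)⟩)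

lemma partialSums_injective {n : ℕ} : Function.Injective (partialSums (n := n)) :=
  Function.LeftInverse.injective co_partialSums

/-- The composition `(n)` with at most one part (the empty composition if `n = 0`). -/
def whole (n : ℕ) : Composition n :=
  if h : 0 < n then Composition.single n h else Composition.ones n

/-- The fundamental quasisymmetric function `F_α = ∑_{β ≥ α} M_β`, summed over the compositions `β`
of `n` that refine `α`, that is, with `S_α ⊆ S_β`. -/
def F {n : ℕ} (α : Composition n) : QSym :=
  ∑ β : Composition n with partialSums α ⊆ partialSums β, M β

lemma F_mem {n : ℕ} (α : Composition n) : F α ∈ QSymDeg n :=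
  Submodule.sum_mem _ fun β _ => Submodule.subset_span ⟨β, rfl⟩

lemma M_mem_span_F {n : ℕ} (α : Composition n) :
    M α ∈ Submodule.span ℚ (Set.range (F : Composition n → QSym)) := by
  classical
  have hlt : ∀ α : Composition n, (partialSums α).card ≤ n + 1 := by
    intro α
    refine (Finset.card_le_card Finset.sdiff_subset).trans (Finset.card_image_le.trans ?_)
    exact (Finset.card_le_univ _).trans (by simp)
  induction hk : n + 1 - (partialSums α).card using Nat.strong_induction_on generalizing α with
  | _ k ih =>
    have hF : F α = M α +
        ∑ β ∈ (Finset.univ.filter fun β : Composition n =>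
          partialSums α ⊆ partialSums β).erase α, M β := by
      rw [F, Finset.add_sum_erase]
      simp
    have hM : M α = F α - ∑ β ∈ (Finset.univ.filter fun β : Composition n =>
          partialSums α ⊆ partialSums β).erase α, M β := by
      rw [hF, add_sub_cancel_right]
    rw [hM]
    refine Submodule.sub_mem _ (Submodule.subset_span ⟨α, rfl⟩)
      (Submodule.sum_mem _ fun β hβ => ?_)
    simp only [Finset.mem_erase, Finset.mem_filter, Finset.mem_univ, true_and] at hβ
    refine ih _ ?_ β rfl
    have : (partialSums α).card < (partialSums β).card :=
      Finset.card_lt_card (Finset.ssubset_iff_subset_ne.mpr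
        ⟨hβ.2, fun h => hβ.1 (partialSums_injective h).symm⟩)
    have := hlt β
    omega

lemma linearIndependent_M_deg (n : ℕ) :
    LinearIndependent ℚ (M : Composition n → QSym) :=
  linearIndependent_M.comp (fun α : Composition n => (⟨n, α⟩ : Σ n, Composition n))
    sigma_mk_injective

lemma span_F (n : ℕ) :
    Submodule.span ℚ (Set.range (F : Composition n → QSym)) = QSymDeg n := by
  refine le_antisymm (Submodule.span_le.mpr ?_) (Submodule.span_le.mpr ?_)
  · rintro _ ⟨α, rfl⟩
    exact F_mem α
  · rintro _ ⟨α, rfl⟩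
    exact M_mem_span_F α

lemma linearIndependent_F (n : ℕ) : LinearIndependent ℚ (F : Composition n → QSym) := by
  rw [linearIndependent_iff_card_eq_finrank_span, Set.finrank, span_F, QSymDeg]
  exact (finrank_span_eq_card (linearIndependent_M_deg n)).symm

/-- The basis of the degree `n` component formed by the fundamental quasisymmetric functions. -/
def fBasis (n : ℕ) : Module.Basis (Composition n) ℚ (QSymDeg n) :=
  (Module.Basis.span (linearIndependent_F n)).map (LinearEquiv.ofEq _ _ (span_F n))

lemma fBasis_apply {n : ℕ} (α : Composition n) : (fBasis n α : QSym) = F α := by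
  simp [fBasis, Module.Basis.span_apply]

/-! ### Descents and the random walk on permutations -/

/-- The descent set `{i ∈ {1, …, n - 1} : σ_i > σ_{i+1}}`. (With `Fin n = {0, …, n - 1}`, the
value `σ_{i+1}` of the one-line notation is `σ i`.) -/
def desSet {n : ℕ} (σ : Equiv.Perm (Fin n)) : Finset ℕ :=
  (Finset.range n).filter fun i => ∃ (h0 : 0 < i) (h : i < n), σ ⟨i, h⟩ < σ ⟨i - 1, by omega⟩

/-- The descent composition `D(σ) = co(Des(σ))`. -/
def D {n : ℕ} (σ : Equiv.Perm (Fin n)) : Composition n := co n (desSet σ)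

lemma partialSums_D {n : ℕ} (σ : Equiv.Perm (Fin n)) : partialSums (D σ) = desSet σ := by
  refine partialSums_co fun i hi => ?_
  simp only [desSet, Finset.mem_filter] at hi
  obtain ⟨-, h0, h, -⟩ := hi
  exact ⟨h0, h⟩

/-- The coefficients `c_{α,β}` of `Φ(F_α) = ∑_β c_{α,β} F_β`. -/
def QSymEnd.c (Φ : QSymEnd) {n : ℕ} (α β : Composition n) : ℚ :=
  (fBasis n).repr ⟨Φ.lin (F α), Φ.map_deg n _ (F_mem α)⟩ β

lemma QSymEnd.c_spec (Φ : QSymEnd) {n : ℕ} (α : Composition n) :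
    Φ.lin (F α) = ∑ β, Φ.c α β • F β := by
  have h := congrArg Subtype.val
    ((fBasis n).sum_repr ⟨Φ.lin (F α), Φ.map_deg n _ (F_mem α)⟩)
  simp only [Submodule.coe_sum, Submodule.coe_smul, fBasis_apply] at h
  exact h.symm

/-- The scalar `λ` with `Φ(M_1) = λ M_1`, as the coefficient of `x₀` in `Φ(M_1)`. -/
def QSymEnd.lam (Φ : QSymEnd) : ℚ :=
  MvPowerSeries.coeff (Finsupp.single 0 1) (Φ.lin (M (whole 1)) : MvPowerSeries ℕ ℚ)

lemma QSymEnd.lam_spec (Φ : QSymEnd) : Φ.lin (M (whole 1)) = Φ.lam • M (whole 1) := by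
  have h : Φ.lin (M (whole 1)) ∈ QSymDeg 1 :=
    Φ.map_deg 1 _ (Submodule.subset_span ⟨whole 1, rfl⟩)
  have hr : Set.range (M : Composition 1 → QSym) = {M (whole 1)} := by
    ext x
    have : ∀ α : Composition 1, α = whole 1 := by
      have : Subsingleton (Composition 1) :=
        Fintype.card_le_one_iff_subsingleton.mp (by rw [composition_card]; simp)
      exact fun α => Subsingleton.elim _ _
    simp only [Set.mem_range, Set.mem_singleton_iff]
    exact ⟨fun ⟨α, hα⟩ => by rw [← hα, this α], fun hx => ⟨_, hx.symm⟩⟩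
  rw [QSymDeg, hr, Submodule.mem_span_singleton] at h
  obtain ⟨a, ha⟩ := h
  have hexp : expList (Finsupp.single 0 1) = (whole 1).blocks := by
    simp [expList, whole]
  have : Φ.lam = a := by
    rw [QSymEnd.lam, ← ha]
    change MvPowerSeries.coeff _ (a • monoSeries (whole 1).blocks) = a
    rw [MvPowerSeries.coeff_smul, coeff_monoSeries, if_pos hexp, mul_one]
  rw [this, ha]

/-- The distribution on permutations with `Prob_Φ(π) = c_{D(π),n} / ∑_σ c_{D(σ),n}`. -/
def QSymEnd.prob (Φ : QSymEnd) {n : ℕ} (π : Equiv.Perm (Fin n)) : ℚ :=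
  Φ.c (D π) (whole n) / ∑ σ : Equiv.Perm (Fin n), Φ.c (D σ) (whole n)

/-- The transition matrix of the walk in which `π` goes to `σ π` with probability
`Prob_Φ(σ⁻¹)`: `K(π, σ π) = Prob_Φ(σ⁻¹)`, that is, `K(π, τ) = Prob_Φ(π τ⁻¹)`. -/
def QSymEnd.K (Φ : QSymEnd) (n : ℕ) : Matrix (Equiv.Perm (Fin n)) (Equiv.Perm (Fin n)) ℚ :=
  Matrix.of fun π τ => Φ.prob (π * τ⁻¹)

lemma QSymEnd.K_apply_mul (Φ : QSymEnd) {n : ℕ} (π σ : Equiv.Perm (Fin n)) :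
    Φ.K n π (σ * π) = Φ.prob σ⁻¹ := by
  simp [QSymEnd.K]

/-! ### The partitioning property and the matrix on equivalence classes -/

/-- `Φ_n` has the partitioning property with respect to the equivalence relation `r` on the
compositions of `n`: `Φ(F_α)` depends only on the class of `α`, and these elements, one for each
class, form a basis of `Φ(QSym_n)`. -/
structure HasPartition (Φ : QSymEnd) (n : ℕ) (r : Setoid (Composition n)) : Prop where
  const : ∀ α β : Composition n, r α β → Φ.lin (F α) = Φ.lin (F β)
  linInd : LinearIndependent ℚ
    (Quotient.lift (fun α : Composition n => Φ.lin (F α)) const : Quotient r → QSym)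
  span_eq : Submodule.span ℚ (Set.range
      (Quotient.lift (fun α : Composition n => Φ.lin (F α)) const : Quotient r → QSym)) =
    (QSymDeg n).map Φ.lin

instance instFintypeQuotient {n : ℕ} (r : Setoid (Composition n)) : Fintype (Quotient r) :=
  Fintype.ofFinite _

variable {Φ : QSymEnd} {n : ℕ} {r : Setoid (Composition n)}

/-- The element `φ_{[α]} = Φ(F_α)` attached to an equivalence class. -/
def HasPartition.phi (h : HasPartition Φ n r) : Quotient r → QSym :=
  Quotient.lift (fun α : Composition n => Φ.lin (F α)) h.const

/-- The elements `φ_a` as a basis of `Φ(QSym_n)`. -/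
def HasPartition.basis (h : HasPartition Φ n r) :
    Module.Basis (Quotient r) ℚ ((QSymDeg n).map Φ.lin) :=
  (Module.Basis.span h.linInd).map (LinearEquiv.ofEq _ _ h.span_eq)

lemma HasPartition.basis_apply (h : HasPartition Φ n r) (a : Quotient r) :
    (h.basis a : QSym) = h.phi a := by
  simp [HasPartition.basis, HasPartition.phi, Module.Basis.span_apply]

lemma HasPartition.map_phi_mem (h : HasPartition Φ n r) (a : Quotient r) :
    Φ.lin (h.phi a) ∈ (QSymDeg n).map Φ.lin := by
  induction a using Quotient.inductionOn with
  | h α => exact Submodule.mem_map_of_mem (Φ.map_deg n _ (F_mem α))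

/-- The coefficients `d_{a,b}` of `Φ(φ_a) = ∑_b d_{a,b} φ_b`. -/
def HasPartition.d (h : HasPartition Φ n r) (a b : Quotient r) : ℚ :=
  h.basis.repr ⟨Φ.lin (h.phi a), h.map_phi_mem a⟩ b

lemma HasPartition.d_spec (h : HasPartition Φ n r) (a : Quotient r) :
    Φ.lin (h.phi a) = ∑ b, h.d a b • h.phi b := by
  have h1 := congrArg Subtype.val
    (h.basis.sum_repr ⟨Φ.lin (h.phi a), h.map_phi_mem a⟩)
  simp only [Submodule.coe_sum, Submodule.coe_smul, h.basis_apply] at h1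
  exact h1.symm

/-- The matrix `K̂(a, b) = λ⁻ⁿ d_{a,b}` on equivalence classes (meaningful if `λⁿ ≠ 0`). -/
def HasPartition.Khat (h : HasPartition Φ n r) : Matrix (Quotient r) (Quotient r) ℚ :=
  Matrix.of fun a b => 1 / Φ.lam ^ n * h.d a b

open Classical in
/-- Stochastic matrices: nonnegative entries, and every row sums to `1`. -/
def IsStochastic {ι : Type*} [Fintype ι] (A : Matrix ι ι ℚ) : Prop :=
  A ∈ Matrix.rowStochastic ℚ ι

open Classical in
/-- `B` lumps the transition matrix `A` along the map `f`: the probability of moving from a state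
`x` into a fibre of `f` depends only on `f x`, and it is the corresponding entry of `B`. -/
structure Lumps {ι κ : Type*} [Fintype ι] (A : Matrix ι ι ℚ) (f : ι → κ) (B : Matrix κ κ ℚ) :
    Prop where
  lumpable : ∀ (b : κ) (x y : ι), f x = f y →
    ∑ z : ι with f z = b, A x z = ∑ z : ι with f z = b, A y z
  entry : ∀ (x : ι) (b : κ), B (f x) b = ∑ z : ι with f z = b, A x z

/-- The equivalence class of the descent composition of a permutation. -/
def descentClass {n : ℕ} (r : Setoid (Composition n)) (σ : Equiv.Perm (Fin n)) : Quotient r :=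
  Quotient.mk r (D σ)

/-! ### Peaks -/

/-- The set `Λ(α) = {i ∈ S_α : i ≠ 1, i - 1 ∉ S_α}`. -/
def peaks {n : ℕ} (α : Composition n) : Finset ℕ :=
  (partialSums α).filter fun i => i ≠ 1 ∧ i - 1 ∉ partialSums α

/-- The peak set `{i ∈ {2, …, n - 1} : π_{i-1} < π_i > π_{i+1}}` of a permutation. (With
`Fin n = {0, …, n - 1}`, the value `π_{i+1}` of the one-line notation is `π i`.) -/
def peakSet {n : ℕ} (π : Equiv.Perm (Fin n)) : Finset ℕ :=
  (Finset.range n).filter fun i => ∃ (h0 : 2 ≤ i) (h : i < n),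
    π ⟨i - 2, by omega⟩ < π ⟨i - 1, by omega⟩ ∧ π ⟨i, h⟩ < π ⟨i - 1, by omega⟩

lemma peaks_D {n : ℕ} (π : Equiv.Perm (Fin n)) : peaks (D π) = peakSet π := by
  ext i
  simp only [peaks, partialSums_D, peakSet, desSet, Finset.mem_filter, Finset.mem_range]
  constructor
  · rintro ⟨⟨hn, h0, h, hd⟩, h1, h2⟩
    refine ⟨hn, by omega, h, ?_, hd⟩
    by_contra hlt
    apply h2
    refine ⟨by omega, by omega, by omega, ?_⟩
    refine lt_of_le_of_ne (not_lt.mp hlt) fun he => ?_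
    have := congrArg Fin.val (π.injective he)
    simp only at this
    omega
  · rintro ⟨hn, h2, h, hlt, hd⟩
    refine ⟨⟨hn, by omega, h, hd⟩, by omega, ?_⟩
    rintro ⟨-, _, _, h5⟩
    exact absurd h5 (not_lt.mpr hlt.le)

/-- Two compositions of `n` are equivalent if they have the same peaks. -/
def peakSetoid (n : ℕ) : Setoid (Composition n) := Setoid.ker peaks

/-- `Θ` is Stembridge's map: `Θ(F_α) = 2 ^ (|Λ(α)| + 1) ∑ F_β` for every composition `α` of
`n ≥ 1`, summed over the compositions `β` of `n` with `Λ(α) ⊆ S_β ∆ (S_β + 1)`. -/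
def IsStembridge (Θ : QSymEnd) : Prop :=
  ∀ (n : ℕ), 0 < n → ∀ α : Composition n,
    Θ.lin (F α) = (2 : ℚ) ^ ((peaks α).card + 1) •
      ∑ β : Composition n with
        peaks α ⊆ symmDiff (partialSums β) ((partialSums β).image (· + 1)), F β

end QS

end

open QS

/-!
A word `w : Fin n → ℕ` together with the one-line notation of a permutation `π` gives keys
`(w_i, π_i)`, and `F_{D(π)}` is the generating function of the words whose keys increase
lexicographically. Sorting arbitrary keys by their ranking permutation `τ` yields the shuffle rule:
the product of the functions `F` attached to the consecutive segments of `π` is the sum of the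
`F_{D(π τ⁻¹)}` over all `τ` that ascend inside each segment (`wordSum_eq_sum_perm`,
`blockProd_eq_sum`).

An endomorphism `Φ` is a coalgebra homomorphism, and the coproduct cuts ribbons into segments
(`comul_F_co`), so the coefficient of `M_β` in `Φ(F_{D(π)})` is the product, over the segments of
`π` cut out by `β`, of coefficients of powers of `x₀`. Since `Φ` is also multiplicative, the shuffle
rule turns this product into a sum, with the result (`QSymEnd.lin_F_D`)
`Φ(F_{D(π)}) = ∑_τ c_{D(π τ⁻¹), n} F_{D(τ)}`.
For `β = (1, …, 1)` the same coefficient is `λⁿ`, whence `∑_σ c_{D(σ), n} = λⁿ`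
(`QSymEnd.sum_c_D`). Thus `K(π, τ) = λ⁻ⁿ c_{D(π τ⁻¹), n}`; applying `Φ` once more to the formula
expresses `Φ(φ_{[D(π)]})` in the `φ_b` with coefficients the sums of `λⁿ K(π, τ)` over the classes,
which is the lumping (`HasPartition.stochastic_and_lumps`).

Stembridge's map is defined by sending `F_α` to the peak function `peakFun α`. The latter is the
generating function of signed words, in which equal negative letters require descents and equal
positive letters require ascents (`agreeBelow_peakFun`, by the count of signs `card_signs`). The
shuffle rule holds for such words too, with the same permutations `τ`, so the map is multiplicative
(`peakMap_mul`); compatibility with the coproduct is a statement about peaks of segments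
(`peakWeight_append`). A halving argument gives the expansion of peak functions in the fundamental
basis (`card_exactly_one`), and a triangularity argument their linear independence
(`sum_lt_sum_of_forall_mem_or`).
-/

noncomputable section

namespace QS

/-! ### Partial sums and coefficients -/

/-- The set of all sums of initial segments of a list, the empty sum and the total included. -/
def listSums (L : List ℕ) : Set ℕ := {s | ∃ k, (L.take k).sum = s}

lemma zero_mem_listSums (L : List ℕ) : 0 ∈ listSums L := ⟨0, by simp⟩

lemma sum_mem_listSums (L : List ℕ) : L.sum ∈ listSums L := ⟨L.length, by simp⟩

lemma le_sum_of_mem_listSums {L : List ℕ} {s : ℕ} (h : s ∈ listSums L) : s ≤ L.sum := by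
  obtain ⟨k, rfl⟩ := h
  conv_rhs => rw [← List.take_append_drop k L, List.sum_append]
  omega

lemma mem_listSums_cons {b s : ℕ} {L : List ℕ} :
    s ∈ listSums (b :: L) ↔ s = 0 ∨ ∃ j ∈ listSums L, s = b + j := by
  constructor
  · rintro ⟨k, rfl⟩
    cases k with
    | zero => exact Or.inl (by simp)
    | succ k => exact Or.inr ⟨_, ⟨k, rfl⟩, by simp⟩
  · rintro (rfl | ⟨_, ⟨k, rfl⟩, rfl⟩)
    · exact zero_mem_listSums _
    · exact ⟨k + 1, by simp⟩

lemma add_mem_listSums_cons {b j : ℕ} {L : List ℕ} :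
    b + j ∈ listSums (b :: L) ↔ j ∈ listSums L := by
  rw [mem_listSums_cons]
  constructor
  · rintro (h | ⟨i, hi, h⟩)
    · rw [show j = 0 by omega]; exact zero_mem_listSums L
    · rwa [show j = i by omega]
  · exact fun h => Or.inr ⟨j, h, rfl⟩

lemma mem_listSums_append {s : ℕ} {L L' : List ℕ} :
    s ∈ listSums (L ++ L') ↔ s ∈ listSums L ∨ ∃ j ∈ listSums L', s = L.sum + j := by
  induction L generalizing s with
  | nil =>
    constructor
    · exact fun h => Or.inr ⟨s, h, by simp⟩
    · rintro (⟨k, rfl⟩ | ⟨j, hj, rfl⟩)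
      · simpa using zero_mem_listSums L'
      · simpa using hj
  | cons b L ih =>
    simp only [List.cons_append, mem_listSums_cons, ih, List.sum_cons]
    constructor
    · rintro (rfl | ⟨j, hj | ⟨i, hi, rfl⟩, rfl⟩)
      · exact Or.inl (Or.inl rfl)
      · exact Or.inl (Or.inr ⟨j, hj, rfl⟩)
      · exact Or.inr ⟨i, hi, by omega⟩
    · rintro ((rfl | ⟨j, hj, rfl⟩) | ⟨i, hi, rfl⟩)
      · exact Or.inl rfl
      · exact Or.inr ⟨j, Or.inl hj, rfl⟩
      · exact Or.inr ⟨L.sum + i, Or.inr ⟨i, hi, rfl⟩, by omega⟩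

lemma mem_listSums_append_of_le {s : ℕ} {L L' : List ℕ} (h : s ≤ L.sum) :
    s ∈ listSums (L ++ L') ↔ s ∈ listSums L := by
  rw [mem_listSums_append]
  refine or_iff_left_of_imp ?_
  rintro ⟨j, -, rfl⟩
  rw [show j = 0 by omega]
  exact sum_mem_listSums L

lemma add_mem_listSums_append {j : ℕ} {L L' : List ℕ} :
    L.sum + j ∈ listSums (L ++ L') ↔ j ∈ listSums L' := by
  rw [mem_listSums_append]
  constructor
  · rintro (h | ⟨i, hi, h⟩)
    · rw [show j = 0 by have := le_sum_of_mem_listSums h; omega]; exact zero_mem_listSums L'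
    · rwa [show j = i by omega]
  · exact fun h => Or.inr ⟨j, h, rfl⟩

lemma mem_partialSums {n : ℕ} {α : Composition n} {i : ℕ} :
    i ∈ partialSums α ↔ 0 < i ∧ i < n ∧ i ∈ listSums α.blocks := by
  simp only [partialSums, Finset.mem_sdiff, Finset.mem_image, Finset.mem_insert,
    Finset.mem_singleton, not_or, Composition.boundaries, Finset.mem_map, Finset.mem_univ, true_and]
  constructor
  · rintro ⟨⟨_, ⟨k, rfl⟩, rfl⟩, h0, hn⟩
    have h1 : (α.boundary k : ℕ) = α.sizeUpTo k := rfl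
    have h2 := α.sizeUpTo_le k
    refine ⟨by omega, ?_, k, rfl⟩
    change (α.boundary k : ℕ) < n
    change ¬ (α.boundary k : ℕ) = n at hn
    omega
  · rintro ⟨h0, hn, k, rfl⟩
    have hk : k < α.length + 1 := by
      by_contra hk
      have := α.sizeUpTo_ofLength_le k (by omega)
      rw [Composition.sizeUpTo] at this
      omega
    exact ⟨⟨_, ⟨⟨k, hk⟩, rfl⟩, rfl⟩, by omega, by omega⟩

lemma mem_partialSums_co {n : ℕ} {T : Finset ℕ} {i : ℕ} :
    i ∈ partialSums (co n T) ↔ 0 < i ∧ i < n ∧ i ∈ T := by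
  simp only [partialSums, co_boundaries, Finset.mem_sdiff, Finset.mem_image, Finset.mem_filter,
    Finset.mem_univ, true_and, Finset.mem_insert, Finset.mem_singleton, not_or]
  constructor
  · rintro ⟨⟨j, rfl | rfl | hj, rfl⟩, h0, hn⟩
    · exact absurd rfl h0
    · exact absurd rfl hn
    · exact ⟨by omega, by omega, hj⟩
  · rintro ⟨h0, hn, hi⟩
    exact ⟨⟨⟨i, by omega⟩, Or.inr (Or.inr hi), rfl⟩, by omega, by omega⟩

lemma co_congr {n : ℕ} {T T' : Finset ℕ} (h : ∀ i, 0 < i → i < n → (i ∈ T ↔ i ∈ T')) :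
    co n T = co n T' := by
  apply partialSums_injective
  ext i
  simp only [mem_partialSums_co]
  exact ⟨fun ⟨h0, hn, hi⟩ => ⟨h0, hn, (h i h0 hn).mp hi⟩,
    fun ⟨h0, hn, hi⟩ => ⟨h0, hn, (h i h0 hn).mpr hi⟩⟩

lemma blocks_whole (n : ℕ) : (whole n).blocks = if 0 < n then [n] else [] := by
  unfold whole
  split_ifs with h
  · rfl
  · rw [Composition.ones_blocks, show n = 0 by omega, List.replicate_zero]

lemma expList_single (n : ℕ) : expList (Finsupp.single 0 n) = (whole n).blocks := by
  rw [blocks_whole]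
  split_ifs with h
  · rw [expList, Finsupp.support_single _ h.ne']
    simp
  · rw [show n = 0 by omega]
    simp [expList]

lemma coeff_M {n : ℕ} (α : Composition n) (m : ℕ →₀ ℕ) :
    MvPowerSeries.coeff m (M α : MvPowerSeries ℕ ℚ) = if expList m = α.blocks then 1 else 0 := rfl

/-- The coefficients of a combination of monomial quasisymmetric functions of degree `n`, the
scalars being given as a function of the list of parts. -/
lemma coeff_sum_smul_M (n : ℕ) (g : List ℕ → ℚ) (m : ℕ →₀ ℕ) :
    MvPowerSeries.coeff m ((∑ β : Composition n, g β.blocks • M β : QSym) : MvPowerSeries ℕ ℚ) =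
      if m.degree = n then g (expList m) else 0 := by
  have h : ((∑ β : Composition n, g β.blocks • M β : QSym) : MvPowerSeries ℕ ℚ) =
      ∑ β : Composition n, g β.blocks • (M β : MvPowerSeries ℕ ℚ) := by
    simp
  rw [h, map_sum]
  simp only [MvPowerSeries.coeff_smul, coeff_M, mul_ite, mul_one, mul_zero]
  split_ifs with hm
  · subst hm
    rw [Finset.sum_eq_single
      (⟨expList m, fun h => expList_pos h, expList_sum m⟩ : Composition m.degree)]
    · rw [if_pos rfl]
    · exact fun α _ hα => if_neg fun h => hα (Composition.ext h.symm)
    · exact fun h => absurd (Finset.mem_univ _) h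
  · refine Finset.sum_eq_zero fun β _ => if_neg fun h => hm ?_
    rw [← expList_sum, h, β.blocks_sum]

open Classical in
lemma F_eq_sum_smul {n : ℕ} (α : Composition n) :
    F α = ∑ β : Composition n,
      (if ∀ i ∈ partialSums α, i ∈ listSums β.blocks then (1 : ℚ) else 0) • M β := by
  rw [F, Finset.sum_filter]
  refine Finset.sum_congr rfl fun β _ => ?_
  have : partialSums α ⊆ partialSums β ↔ ∀ i ∈ partialSums α, i ∈ listSums β.blocks := by
    constructor
    · exact fun h i hi => (mem_partialSums.mp (h hi)).2.2
    · intro h i hi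
      have hi' := mem_partialSums.mp hi
      exact mem_partialSums.mpr ⟨hi'.1, hi'.2.1, h i hi⟩
  rw [ite_smul, one_smul, zero_smul]
  exact if_congr this rfl rfl

open Classical in
lemma coeff_F {n : ℕ} (α : Composition n) (m : ℕ →₀ ℕ) :
    MvPowerSeries.coeff m (F α : MvPowerSeries ℕ ℚ) =
      if m.degree = n ∧ ∀ i ∈ partialSums α, i ∈ listSums (expList m) then 1 else 0 := by
  rw [F_eq_sum_smul, coeff_sum_smul_M n
    (fun L => if ∀ i ∈ partialSums α, i ∈ listSums L then (1 : ℚ) else 0), ite_and]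

open Classical in
lemma coeff_F_co (n : ℕ) (T : Finset ℕ) (m : ℕ →₀ ℕ) :
    MvPowerSeries.coeff m (F (co n T) : MvPowerSeries ℕ ℚ) =
      if m.degree = n ∧ ∀ i ∈ T, 0 < i → i < n → i ∈ listSums (expList m) then 1 else 0 := by
  rw [coeff_F]
  refine if_congr (and_congr_right fun _ => ?_) rfl rfl
  simp only [mem_partialSums_co]
  exact ⟨fun h i hi h0 hn => h i ⟨h0, hn, hi⟩, fun h i hi => h i hi.2.2 hi.1 hi.2.1⟩

/-! ### Coefficients along lists and the coproduct -/

/-- The coefficient of `x₀ ^ a₁ ⋯ x_{k-1} ^ aₖ`, where `L = [a₁, …, aₖ]`. -/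
def coef (L : List ℕ) : QSym →ₗ[ℚ] ℚ :=
  (MvPowerSeries.coeff L.toFinsupp).comp QSym.val.toLinearMap

lemma coef_apply (L : List ℕ) (f : QSym) :
    coef L f = MvPowerSeries.coeff L.toFinsupp (f : MvPowerSeries ℕ ℚ) := rfl

lemma coef_M {n : ℕ} {L : List ℕ} (hL : ∀ a ∈ L, 0 < a) (α : Composition n) :
    coef L (M α) = if L = α.blocks then 1 else 0 := by
  rw [coef_apply, coeff_M, expList_toFinsupp hL]

lemma degree_toFinsupp {L : List ℕ} (hL : ∀ a ∈ L, 0 < a) : L.toFinsupp.degree = L.sum := by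
  rw [← expList_sum, expList_toFinsupp hL]

lemma coeff_eq_coef_expList (f : QSym) (m : ℕ →₀ ℕ) :
    MvPowerSeries.coeff m (f : MvPowerSeries ℕ ℚ) = coef (expList m) f :=
  ((mem_qsymSpan_iff f.1).mp f.2).1 _ _ (expList_toFinsupp fun _ => expList_pos).symm

lemma coef_eq_zero_of_mem {n : ℕ} {f : QSym} (hf : f ∈ QSymDeg n) {L : List ℕ}
    (hL : ∀ a ∈ L, 0 < a) (h : L.sum ≠ n) : coef L f = 0 := by
  suffices h : QSymDeg n ≤ LinearMap.ker (coef L) from h hf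
  refine Submodule.span_le.mpr ?_
  rintro _ ⟨α, rfl⟩
  refine (coef_M hL α).trans (if_neg fun h' => h ?_)
  rw [h', α.blocks_sum]

lemma ext_coef {f g : QSym} (h : ∀ L : List ℕ, (∀ a ∈ L, 0 < a) → coef L f = coef L g) :
    f = g := by
  apply Subtype.ext
  ext m
  rw [coeff_eq_coef_expList, coeff_eq_coef_expList, h _ fun _ => expList_pos]

open Classical in
lemma coef_F_co (n : ℕ) (T : Finset ℕ) {L : List ℕ} (hL : ∀ a ∈ L, 0 < a) :
    coef L (F (co n T)) =
      if L.sum = n ∧ ∀ i ∈ T, 0 < i → i < n → i ∈ listSums L then 1 else 0 := by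
  rw [coef_apply, coeff_F_co, degree_toFinsupp hL, expList_toFinsupp hL]

/-- The tensor product of two linear functionals, as a functional. -/
def tensorFun (φ ψ : QSym →ₗ[ℚ] ℚ) : QSym ⊗[ℚ] QSym →ₗ[ℚ] ℚ :=
  LinearMap.mul' ℚ ℚ ∘ₗ TensorProduct.map φ ψ

@[simp]
lemma tensorFun_tmul (φ ψ : QSym →ₗ[ℚ] ℚ) (f g : QSym) :
    tensorFun φ ψ (f ⊗ₜ g) = φ f * ψ g := by
  simp [tensorFun]

/-- The coproduct is dual to the concatenation of exponent lists. -/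
lemma tensorFun_coef_comul {L L' : List ℕ} (hL : ∀ a ∈ L, 0 < a) (hL' : ∀ a ∈ L', 0 < a)
    (f : QSym) : tensorFun (coef L) (coef L') (comul f) = coef (L ++ L') f := by
  have hLL : ∀ a ∈ L ++ L', 0 < a := fun a ha =>
    (List.mem_append.mp ha).elim (hL a) (hL' a)
  suffices h : tensorFun (coef L) (coef L') ∘ₗ comul = coef (L ++ L') from
    LinearMap.congr_fun h f
  refine mBasis.ext fun ⟨n, α⟩ => ?_
  rw [mBasis_apply, LinearMap.comp_apply, comul_M, map_sum, coef_M hLL]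
  simp only [tensorFun_tmul, coef_M hL, coef_M hL', takeComp, dropComp]
  split_ifs with h
  · rw [Finset.sum_eq_single L.length]
    · simp [← h]
    · intro i hi hne
      rw [Finset.mem_range, ← α.blocks_length] at hi
      rw [if_neg, zero_mul]
      rintro h'
      apply hne
      rw [h', List.length_take]
      omega
    · intro hi
      rw [Finset.mem_range, ← α.blocks_length, ← h, List.length_append] at hi
      omega
  · refine Finset.sum_eq_zero fun i _ => ?_
    by_cases h1 : L = α.blocks.take i
    · rw [if_neg (c := L' = _), mul_zero]
      exact fun h2 => h (by rw [h1, h2, List.take_append_drop])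
    · rw [if_neg h1, zero_mul]

lemma ext_tensorFun_coef {x y : QSym ⊗[ℚ] QSym}
    (h : ∀ L L' : List ℕ, (∀ a ∈ L, 0 < a) → (∀ a ∈ L', 0 < a) →
      tensorFun (coef L) (coef L') x = tensorFun (coef L) (coef L') y) : x = y := by
  have key : ∀ (α β : Σ n, Composition n) (z : QSym ⊗[ℚ] QSym),
      (mBasis.tensorProduct mBasis).repr z (α, β) =
        tensorFun (coef α.2.blocks) (coef β.2.blocks) z := by
    intro α β z
    suffices h : (mBasis.tensorProduct mBasis).coord (α, β) =
        tensorFun (coef α.2.blocks) (coef β.2.blocks) from LinearMap.congr_fun h z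
    refine (mBasis.tensorProduct mBasis).ext fun ⟨γ, δ⟩ => ?_
    rw [Module.Basis.coord_apply, Module.Basis.repr_self, Module.Basis.tensorProduct_apply,
      mBasis_apply, mBasis_apply, tensorFun_tmul, coef_M fun _ => α.2.blocks_pos,
      coef_M fun _ => β.2.blocks_pos, Finsupp.single_apply]
    simp only [← Composition.sigma_eq_iff_blocks_eq, Prod.mk.injEq]
    split_ifs <;> simp_all
  refine (mBasis.tensorProduct mBasis).ext_elem fun ⟨α, β⟩ => ?_
  rw [key, key]
  exact h _ _ (fun _ => α.2.blocks_pos) fun _ => β.2.blocks_pos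

lemma indicator_mul_indicator (p q : Prop) [Decidable p] [Decidable q] [Decidable (p ∧ q)] :
    (if p then (1 : ℚ) else 0) * (if q then 1 else 0) = if p ∧ q then 1 else 0 := by
  by_cases hp : p <;> by_cases hq : q <;> simp [hp, hq]

/-- The set `{j : j + b ∈ T}`. -/
def shiftSet (b : ℕ) (T : Finset ℕ) : Finset ℕ := T.preimage (· + b) (add_left_injective b).injOn

@[simp]
lemma mem_shiftSet {b j : ℕ} {T : Finset ℕ} : j ∈ shiftSet b T ↔ j + b ∈ T :=
  Finset.mem_preimage

/-- The coproduct of a fundamental quasisymmetric function cuts its ribbon between two consecutive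
cells, or at one of the ends. -/
lemma comul_F_co (n : ℕ) (T : Finset ℕ) :
    comul (F (co n T)) =
      ∑ i ∈ Finset.range (n + 1), F (co i T) ⊗ₜ[ℚ] F (co (n - i) (shiftSet i T)) := by
  classical
  refine ext_tensorFun_coef fun L L' hL hL' => ?_
  have hLL : ∀ a ∈ L ++ L', 0 < a := fun a ha =>
    (List.mem_append.mp ha).elim (hL a) (hL' a)
  rw [tensorFun_coef_comul hL hL', map_sum, coef_F_co _ _ hLL, List.sum_append]
  simp only [tensorFun_tmul, coef_F_co _ _ hL, coef_F_co _ _ hL', indicator_mul_indicator]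
  by_cases hn : L.sum + L'.sum = n
  · rw [Finset.sum_eq_single L.sum]
    · refine if_congr ?_ rfl rfl
      constructor
      · rintro ⟨-, h⟩
        refine ⟨⟨rfl, fun i hi h0 hl => ?_⟩, by omega, fun i hi h0 hl => ?_⟩
        · exact (mem_listSums_append_of_le hl.le).mp (h i hi h0 (by omega))
        · rw [mem_shiftSet, add_comm] at hi
          exact add_mem_listSums_append.mp (h _ hi (by omega) (by omega))
      · rintro ⟨⟨-, h1⟩, -, h2⟩
        refine ⟨hn, fun i hi h0 hl => ?_⟩
        rcases lt_trichotomy i L.sum with h | rfl | h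
        · exact (mem_listSums_append_of_le h.le).mpr (h1 i hi h0 h)
        · exact (mem_listSums_append_of_le le_rfl).mpr (sum_mem_listSums L)
        · obtain ⟨j, rfl⟩ := Nat.exists_eq_add_of_le h.le
          refine add_mem_listSums_append.mpr (h2 j ?_ (by omega) (by omega))
          rwa [mem_shiftSet, add_comm]
    · exact fun i _ hi => if_neg fun h => hi h.1.1.symm
    · exact fun h => absurd (Finset.mem_range.mpr (by omega)) h
  · rw [if_neg fun h => hn h.1]
    refine (Finset.sum_eq_zero fun i hi => if_neg ?_).symm
    rintro ⟨⟨rfl, -⟩, h, -⟩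
    have := Finset.mem_range.mp hi
    omega

/-! ### Generating functions of words -/

/-- The sequence `q` ascends at every two consecutive positions, except possibly at those numbered
`i - 1, i` (counting from `0`) with `i ∈ S`. -/
def Ascends {n : ℕ} {Γ : Type*} [LT Γ] (S : Set ℕ) (q : Fin n → Γ) : Prop :=
  ∀ (i : ℕ) (h : i + 1 < n), i + 1 ∉ S → q ⟨i, by omega⟩ < q ⟨i + 1, h⟩

lemma ascends_congr {n : ℕ} {Γ : Type*} [LT Γ] {S S' : Set ℕ} {q : Fin n → Γ}
    (h : ∀ i, i + 1 < n → (i + 1 ∈ S ↔ i + 1 ∈ S')) : Ascends S q ↔ Ascends S' q :=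
  forall₂_congr fun i hi => by rw [h i hi]

lemma ascends_empty {n : ℕ} {Γ : Type*} [Preorder Γ] {q : Fin n → Γ} :
    Ascends ∅ q ↔ StrictMono q := by
  constructor
  · intro h
    cases n with
    | zero => exact fun i => i.elim0
    | succ n =>
      exact Fin.strictMono_iff_lt_succ.mpr fun i => h i (by omega) (by simp)
  · exact fun h i hi _ => h (Fin.mk_lt_mk.mpr (Nat.lt_succ_self i))

/-- The ranking permutation of an injective sequence. -/
lemma exists_perm_strictMono {n : ℕ} {Γ : Type*} [LinearOrder Γ] {q : Fin n → Γ}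
    (hq : Function.Injective q) : ∃ τ : Equiv.Perm (Fin n), StrictMono fun i => q (τ⁻¹ i) := by
  refine ⟨(Tuple.sort q)⁻¹, ?_⟩
  rw [inv_inv]
  exact (Tuple.monotone_sort q).strictMono_of_injective (hq.comp (Tuple.sort q).injective)

lemma perm_eq_of_strictMono {n : ℕ} {Γ : Type*} [LinearOrder Γ] {q : Fin n → Γ}
    {τ τ' : Equiv.Perm (Fin n)} (h : StrictMono fun i => q (τ⁻¹ i))
    (h' : StrictMono fun i => q (τ'⁻¹ i)) : τ = τ' := by
  have hq : Function.Injective q := fun a b hab => by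
    have hi := h.injective
    exact τ.injective (hi (by simpa using hab))
  have h1 := Tuple.unique_monotone (f := q) (σ := τ⁻¹) (τ := τ'⁻¹) h.monotone h'.monotone
  exact inv_injective (Equiv.ext fun i => hq (congrFun h1 i))

open Classical in
/-- The generating function `∑ x(w₀) ⋯ x(w_{n-1})` of the words `w` over the alphabet `A` for which
the sequence `κ(w_i, p_i)` ascends except at `S`. The labels `p` break ties between equal letters,
in the way prescribed by `κ`. -/
def wordSum {A Γ R : Type*} [Fintype A] [LT Γ] [CommSemiring R] (κ : A → ℤ → Γ) (x : A → R)
    {n : ℕ} (S : Set ℕ) (p : Fin n → ℤ) : R :=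
  ∑ w : Fin n → A with Ascends S (fun i => κ (w i) (p i)), ∏ i, x (w i)

section

variable {A Γ R : Type*} [Fintype A] [LinearOrder Γ] [CommSemiring R] {κ : A → ℤ → Γ} {x : A → R}
  {n : ℕ}

lemma wordSum_congr {S S' : Set ℕ} (h : ∀ i, i + 1 < n → (i + 1 ∈ S ↔ i + 1 ∈ S'))
    (p : Fin n → ℤ) : wordSum κ x S p = wordSum κ x S' p := by
  unfold wordSum
  congr 1
  ext w
  simp only [Finset.mem_filter, Finset.mem_univ, true_and, ascends_congr h]

open Classical in
/-- Sorting the letters: the words that ascend except at `S` are grouped according to the ranking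
permutation `τ` of their keys, which itself ascends except at `S`. -/
lemma wordSum_eq_sum_perm (hκ : ∀ a b s t, κ a s = κ b t → s = t) (S : Set ℕ) {p : Fin n → ℤ}
    (hp : Function.Injective p) :
    wordSum κ x S p =
      ∑ τ ∈ Finset.univ.filter fun τ : Equiv.Perm (Fin n) => Ascends S τ,
        wordSum κ x ∅ fun i => p (τ⁻¹ i) := by
  have h1 : ∀ τ : Equiv.Perm (Fin n), (wordSum κ x ∅ fun i => p (τ⁻¹ i)) =
      ∑ w : Fin n → A,
        if StrictMono fun i => κ (w (τ⁻¹ i)) (p (τ⁻¹ i)) then ∏ i, x (w i) else 0 := by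
    intro τ
    rw [wordSum, Finset.sum_filter]
    refine (Fintype.sum_equiv (Equiv.arrowCongr τ (Equiv.refl A)) _ _ fun w => ?_).symm
    have h2 : ∀ i, (Equiv.arrowCongr τ (Equiv.refl A)) w i = w (τ⁻¹ i) := fun i => rfl
    simp only [h2, ascends_empty]
    refine if_congr Iff.rfl ?_ rfl
    exact (Equiv.prod_comp τ⁻¹ fun i => x (w i)).symm
  simp only [h1]
  rw [Finset.sum_comm, wordSum, Finset.sum_filter]
  refine Finset.sum_congr rfl fun w _ => ?_
  set q : Fin n → Γ := fun i => κ (w i) (p i) with hq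
  have hqi : Function.Injective q := fun i j h => hp (hκ _ _ _ _ h)
  obtain ⟨τ, hτ⟩ := exists_perm_strictMono hqi
  have hA : Ascends S q ↔ Ascends S τ := by
    refine forall₃_congr fun i hi _ => ?_
    have h3 := hτ.lt_iff_lt (a := τ ⟨i, by omega⟩) (b := τ ⟨i + 1, hi⟩)
    simpa using h3
  rw [Finset.sum_filter, Finset.sum_eq_single τ]
  · rw [if_pos (c := StrictMono _) hτ, hA]
  · intro τ' _ hne
    have : ¬ StrictMono fun i => q (τ'⁻¹ i) := fun h => hne (perm_eq_of_strictMono h hτ)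
    rw [if_neg (c := StrictMono _) this, ite_self]
  · exact fun h => absurd (Finset.mem_univ _) h

/-- A position at which no condition is imposed cuts the words into two independent factors. -/
lemma wordSum_add {b c : ℕ} {S : Set ℕ} (hS : b ∈ S) (p : Fin (b + c) → ℤ) :
    wordSum κ x S p =
      wordSum κ x S (fun i => p (Fin.castAdd c i)) *
        wordSum κ x {j | b + j ∈ S} (fun i => p (Fin.natAdd b i)) := by
  classical
  have hA : ∀ q : Fin (b + c) → Γ, Ascends S q ↔
      Ascends S (fun i => q (Fin.castAdd c i)) ∧
        Ascends {j | b + j ∈ S} (fun i => q (Fin.natAdd b i)) := by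
    intro q
    constructor
    · refine fun h => ⟨fun i hi hS => h i (by omega) hS, fun i hi hS => ?_⟩
      exact h (b + i) (by omega) hS
    · rintro ⟨h1, h2⟩ i hi hiS
      rcases lt_trichotomy (i + 1) b with h | h | h
      · exact h1 i h hiS
      · exact absurd (h ▸ hS) hiS
      · obtain ⟨j, rfl⟩ := Nat.exists_eq_add_of_le (Nat.le_of_lt_succ h)
        exact h2 j (by omega) hiS
  simp only [wordSum, Finset.sum_filter]
  rw [Finset.sum_mul_sum, ← Fintype.sum_prod_type', ← (Fin.appendEquiv b c).sum_comp]
  refine Finset.sum_congr rfl fun w _ => ?_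
  simp only [hA, Fin.appendEquiv_apply, Fin.append_left, Fin.append_right, Fin.prod_univ_add]
  by_cases h1 : Ascends S fun i => κ (w.1 i) (p (Fin.castAdd c i)) <;>
    by_cases h2 : Ascends {j | b + j ∈ S} fun i => κ (w.2 i) (p (Fin.natAdd b i)) <;>
    simp [h1, h2]

lemma wordSum_zero (S : Set ℕ) (p : Fin 0 → ℤ) : wordSum κ x S p = 1 := by
  classical
  have : ∀ w : Fin 0 → A, Ascends S fun i => κ (w i) (p i) := fun w i h => by omega
  simp [wordSum, this]

end

/-! ### Contents of words -/

/-- The exponent vector of the monomial `x_{v₀} ⋯ x_{v_{n-1}}`. -/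
def content {n : ℕ} (v : Fin n → ℕ) : ℕ →₀ ℕ := ∑ i, Finsupp.single (v i) 1

lemma degree_content {n : ℕ} (v : Fin n → ℕ) : (content v).degree = n := by
  simp [content]

lemma content_apply {n : ℕ} (v : Fin n → ℕ) (a : ℕ) :
    content v a = (Finset.univ.filter fun i => v i = a).card := by
  simp [content, Finsupp.finsetSum_apply, Finsupp.single_apply]

lemma mem_support_content {n : ℕ} (v : Fin n → ℕ) (i : Fin n) : v i ∈ (content v).support := by
  rw [Finsupp.mem_support_iff, content_apply]
  exact (Finset.card_pos.mpr ⟨i, by simp⟩).ne'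

lemma sum_range_content {n : ℕ} (v : Fin n → ℕ) (a : ℕ) :
    ∑ b ∈ Finset.range a, content v b = (Finset.univ.filter fun i => v i < a).card := by
  rw [Finset.card_eq_sum_card_fiberwise (f := v) (t := Finset.range a)]
  · refine Finset.sum_congr rfl fun b hb => ?_
    rw [content_apply, Finset.filter_filter]
    congr 1
    ext i
    simp only [Finset.mem_filter, Finset.mem_univ, true_and]
    have := Finset.mem_range.mp hb
    exact ⟨fun h => ⟨by omega, h⟩, fun h => h.2⟩
  · intro i hi
    simpa using hi

lemma exists_content_eq {n : ℕ} (m : ℕ →₀ ℕ) (hm : m.degree = n) :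
    ∃ v : Fin n → ℕ, content v = m := by
  induction n generalizing m with
  | zero =>
    refine ⟨Fin.elim0, ?_⟩
    rw [(Finsupp.degree_eq_zero_iff m).mp hm]
    simp [content]
  | succ n ih =>
    obtain ⟨a, ha⟩ : ∃ a, m a ≠ 0 := by
      by_contra! h
      rw [show m = 0 from Finsupp.ext h] at hm
      simp at hm
    have hle : Finsupp.single a 1 ≤ m := by
      rw [Finsupp.single_le_iff]
      omega
    have hsum : Finsupp.single a 1 + (m - Finsupp.single a 1) = m := add_tsub_cancel_of_le hle
    have hdeg : (m - Finsupp.single a 1).degree = n := by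
      have := congrArg Finsupp.degree hsum
      rw [map_add, hm, Finsupp.degree_single] at this
      omega
    obtain ⟨v, hv⟩ := ih _ hdeg
    refine ⟨Fin.cons a v, ?_⟩
    rw [content, Fin.sum_univ_succ]
    simp only [Fin.cons_zero, Fin.cons_succ]
    rw [← content, hv, hsum]

lemma exists_monotone_content_eq {n : ℕ} (m : ℕ →₀ ℕ) (hm : m.degree = n) :
    ∃ v : Fin n → ℕ, Monotone v ∧ content v = m := by
  obtain ⟨v, hv⟩ := exists_content_eq m hm
  refine ⟨v ∘ Tuple.sort v, Tuple.monotone_sort v, ?_⟩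
  rw [← hv]
  exact Equiv.sum_comp (Tuple.sort v) fun i => Finsupp.single (v i) 1

lemma lt_iff_lt_sum_content {n : ℕ} {v : Fin n → ℕ} (hv : Monotone v) (i : Fin n) (a : ℕ) :
    v i < a ↔ (i : ℕ) < ∑ b ∈ Finset.range a, content v b := by
  rw [sum_range_content]
  exact (Tuple.lt_card_lt_iff_apply_lt_of_monotone (j := i) (a := a) hv).symm

lemma monotone_eq_of_content_eq {n : ℕ} {v v' : Fin n → ℕ} (hv : Monotone v) (hv' : Monotone v')
    (h : content v = content v') : v = v' := by
  funext i
  refine eq_of_forall_gt_iff fun a => ?_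
  rw [lt_iff_lt_sum_content hv, lt_iff_lt_sum_content hv', h]

lemma exists_take_eq_filter {l : List ℕ} (hl : l.Pairwise (· < ·)) (k : ℕ) :
    ∃ a, l.take k = l.filter (· < a) := by
  induction l generalizing k with
  | nil => exact ⟨0, by simp⟩
  | cons b l ih =>
    rw [List.pairwise_cons] at hl
    cases k with
    | zero => exact ⟨0, by simp⟩
    | succ k =>
      obtain ⟨a, ha⟩ := ih hl.2 k
      refine ⟨max a (b + 1), ?_⟩
      rw [List.take_succ_cons, ha, List.filter_cons_of_pos (by simp)]
      congr 1
      refine List.filter_congr fun c hc => ?_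
      have := hl.1 c hc
      rw [decide_eq_decide]
      omega

lemma exists_filter_eq_take {l : List ℕ} (hl : l.Pairwise (· < ·)) (a : ℕ) :
    ∃ k, l.filter (· < a) = l.take k := by
  induction l with
  | nil => exact ⟨0, by simp⟩
  | cons b l ih =>
    rw [List.pairwise_cons] at hl
    obtain ⟨k, hk⟩ := ih hl.2
    by_cases hb : b < a
    · exact ⟨k + 1, by rw [List.take_succ_cons, List.filter_cons_of_pos (by simpa using hb), hk]⟩
    · refine ⟨0, ?_⟩
      rw [List.take_zero, List.filter_eq_nil_iff]
      intro c hc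
      rcases List.mem_cons.mp hc with rfl | hc
      · simpa using hb
      · have := hl.1 c hc
        simp only [decide_eq_true_eq]
        omega

lemma mem_listSums_expList {m : ℕ →₀ ℕ} {s : ℕ} :
    s ∈ listSums (expList m) ↔ ∃ a, s = ∑ b ∈ Finset.range a, m b := by
  have hl : m.support.sort.Pairwise (· < ·) := (Finset.sortedLT_sort m.support).pairwise
  have hsum : ∀ a, ((m.support.sort.filter (· < a)).map m).sum = ∑ b ∈ Finset.range a, m b := by
    intro a
    rw [← List.sum_toFinset _ ((Finset.sort_nodup _ _).filter _), List.toFinset_filter,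
      Finset.sort_toFinset]
    have : ({x ∈ m.support | decide (x < a) = true} : Finset ℕ) =
        (Finset.range a).filter fun b => m b ≠ 0 := by
      ext b
      simp [and_comm]
    rw [this, Finset.sum_filter_ne_zero]
  constructor
  · rintro ⟨k, rfl⟩
    obtain ⟨a, ha⟩ := exists_take_eq_filter hl k
    exact ⟨a, by rw [expList, ← List.map_take, ha, hsum]⟩
  · rintro ⟨a, rfl⟩
    obtain ⟨k, hk⟩ := exists_filter_eq_take hl a
    exact ⟨k, by rw [expList, ← List.map_take, ← hk, hsum]⟩

/-- The strict ascents of a weakly increasing word are the partial sums of the exponents of its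
monomial. -/
lemma mem_listSums_expList_content {n : ℕ} {v : Fin n → ℕ} (hv : Monotone v) {i : ℕ}
    (hi : i + 1 < n) :
    i + 1 ∈ listSums (expList (content v)) ↔ v ⟨i, by omega⟩ < v ⟨i + 1, hi⟩ := by
  rw [mem_listSums_expList]
  constructor
  · rintro ⟨a, ha⟩
    have h1 := (lt_iff_lt_sum_content hv ⟨i, by omega⟩ a).mpr
      (by rw [← ha]; exact Nat.lt_succ_self i)
    have h2 := (lt_iff_lt_sum_content hv ⟨i + 1, hi⟩ a).not.mpr (by rw [← ha]; exact lt_irrefl _)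
    omega
  · intro h
    refine ⟨v ⟨i + 1, hi⟩, ?_⟩
    have h1 := (lt_iff_lt_sum_content hv ⟨i, by omega⟩ _).mp h
    have h2 := (lt_iff_lt_sum_content hv ⟨i + 1, hi⟩ (v ⟨i + 1, hi⟩)).not.mp (lt_irrefl _)
    simp only at h1 h2
    omega

lemma prod_X_eq_monomial {n : ℕ} (v : Fin n → ℕ) :
    ∏ i, (MvPowerSeries.X (v i) : MvPowerSeries ℕ ℚ) = MvPowerSeries.monomial (content v) 1 := by
  simp only [MvPowerSeries.X_def, MvPowerSeries.prod_monomial, Finset.prod_const_one, content]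

open Classical in
/-- The words over the lexicographic product of `{0, …, N - 1}` and a set `B` of decorations: the
underlying undecorated word of a monomial is its weakly increasing arrangement, and only the
decorations remain to be counted. -/
lemma coeff_wordSum_lex {B Γ : Type*} [Fintype B] [LinearOrder Γ] (κ : B → ℤ → Γ) {n N : ℕ}
    (p : Fin n → ℤ) (m : ℕ →₀ ℕ) (hN : ∀ i ∈ m.support, i < N) :
    MvPowerSeries.coeff m (wordSum (R := MvPowerSeries ℕ ℚ)
        (fun (a : Fin N × B) (t : ℤ) => toLex (a.1, κ a.2 t)) (fun a => MvPowerSeries.X (a.1 : ℕ))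
        ∅ p) =
      if m.degree = n then
        ((Finset.univ.filter fun s : Fin n → B =>
          Ascends (listSums (expList m)) fun i => κ (s i) (p i)).card : ℚ)
      else 0 := by
  rw [wordSum, map_sum]
  simp only [prod_X_eq_monomial, MvPowerSeries.coeff_monomial]
  split_ifs with hm
  swap
  · refine Finset.sum_eq_zero fun w _ => if_neg fun h => hm ?_
    rw [h, degree_content]
  obtain ⟨v, hv, rfl⟩ := exists_monotone_content_eq m hm
  rw [Finset.sum_boole, Finset.filter_filter]
  congr 1
  symm
  -- A sequence `s` of decorations is attached to the weakly increasing word `v`.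
  refine Finset.card_bij
    (fun s _ => fun i => ((⟨v i, hN _ (mem_support_content v i)⟩ : Fin N), s i)) ?_ ?_ ?_
  · intro s hs
    simp only [Finset.mem_filter, Finset.mem_univ, true_and] at hs ⊢
    refine ⟨fun i hi _ => ?_, trivial⟩
    rw [Prod.Lex.toLex_lt_toLex]
    by_cases h : i + 1 ∈ listSums (expList (content v))
    · exact Or.inl ((mem_listSums_expList_content hv hi).mp h)
    · refine Or.inr ⟨Fin.ext ?_, hs i hi h⟩
      have h1 := (mem_listSums_expList_content hv hi).not.mp h
      have h2 : v ⟨i, by omega⟩ ≤ v ⟨i + 1, hi⟩ := hv (Fin.mk_le_mk.mpr (Nat.le_succ i))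
      simp only
      omega
  · intro s _ s' _ h
    funext i
    exact (Prod.mk.inj (congrFun h i)).2
  · intro w hw
    simp only [Finset.mem_filter, Finset.mem_univ, true_and] at hw
    obtain ⟨hw1, hw2⟩ := hw
    have hmono : Monotone fun i => ((w i).1 : ℕ) := by
      intro i j hij
      have h1 := (ascends_empty.mp hw1).monotone hij
      rw [Prod.Lex.toLex_le_toLex] at h1
      rcases h1 with h1 | h1
      · exact le_of_lt h1
      · exact (congrArg Fin.val h1.1).le
    have hwv : v = fun i => ((w i).1 : ℕ) := monotone_eq_of_content_eq hv hmono hw2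
    refine ⟨fun i => (w i).2, ?_, ?_⟩
    · simp only [Finset.mem_filter, Finset.mem_univ, true_and]
      intro i hi hS
      have h1 := hw1 i hi (by simp)
      rw [Prod.Lex.toLex_lt_toLex] at h1
      refine (h1.resolve_left fun h2 => hS ?_).2
      rw [mem_listSums_expList_content hv hi, hwv]
      exact h2
    · funext i
      exact Prod.ext (Fin.ext (congrFun hwv i)) rfl

/-! ### Products of fundamental quasisymmetric functions -/

/-- Equality of the coefficients of all monomials in the variables `x₀, …, x_{N-1}`. -/
def AgreeBelow (N : ℕ) (f g : MvPowerSeries ℕ ℚ) : Prop :=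
  ∀ m : ℕ →₀ ℕ, (∀ i ∈ m.support, i < N) → MvPowerSeries.coeff m f = MvPowerSeries.coeff m g

lemma eq_of_forall_agreeBelow {f g : MvPowerSeries ℕ ℚ} (h : ∀ N, AgreeBelow N f g) : f = g := by
  ext m
  exact h (m.support.sup id + 1) m fun i hi => Nat.lt_succ_of_le (Finset.le_sup (f := id) hi)

lemma AgreeBelow.mul {N : ℕ} {f f' g g' : MvPowerSeries ℕ ℚ} (hf : AgreeBelow N f f')
    (hg : AgreeBelow N g g') : AgreeBelow N (f * g) (f' * g') := by
  classical
  intro m hm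
  rw [MvPowerSeries.coeff_mul, MvPowerSeries.coeff_mul]
  refine Finset.sum_congr rfl fun p hp => ?_
  have hp' := Finset.HasAntidiagonal.mem_antidiagonal.mp hp
  rw [hf p.1 fun i hi => hm i ?_, hg p.2 fun i hi => hm i ?_]
  · rw [← hp']
    exact Finsupp.support_mono (le_add_of_nonneg_left zero_le) hi
  · rw [← hp']
    exact Finsupp.support_mono (le_add_of_nonneg_right zero_le) hi

lemma AgreeBelow.sum {ι : Type*} {s : Finset ι} {N : ℕ} {f g : ι → MvPowerSeries ℕ ℚ}
    (h : ∀ i ∈ s, AgreeBelow N (f i) (g i)) : AgreeBelow N (∑ i ∈ s, f i) (∑ i ∈ s, g i) := by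
  intro m hm
  rw [map_sum, map_sum]
  exact Finset.sum_congr rfl fun i hi => h i hi m hm

/-- The descent set `{i : 0 < i < n, p_{i-1} > p_i}` of a sequence `p₀, …, p_{n-1}`. -/
def descents {n : ℕ} (p : Fin n → ℤ) : Finset ℕ :=
  (Finset.range n).filter fun i => ∃ (h0 : 0 < i) (h : i < n), p ⟨i, h⟩ < p ⟨i - 1, by omega⟩

lemma succ_mem_descents {n : ℕ} {p : Fin n → ℤ} {i : ℕ} (h : i + 1 < n) :
    i + 1 ∈ descents p ↔ p ⟨i + 1, h⟩ < p ⟨i, by omega⟩ := by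
  simp only [descents, Finset.mem_filter, Finset.mem_range]
  exact ⟨fun ⟨_, _, _, h⟩ => h, fun h' => ⟨h, by omega, h, h'⟩⟩

/-- The one-line notation of a permutation, as a sequence of integers. -/
def labels {n : ℕ} (σ : Equiv.Perm (Fin n)) (i : Fin n) : ℤ := ((σ i : ℕ) : ℤ)

lemma labels_injective {n : ℕ} (σ : Equiv.Perm (Fin n)) : Function.Injective (labels σ) :=
  fun i j h => σ.injective (Fin.ext (by simpa [labels] using h))

lemma desSet_eq_descents {n : ℕ} (σ : Equiv.Perm (Fin n)) : desSet σ = descents (labels σ) := by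
  simp [desSet, descents, labels]

lemma ascends_iff_descents {n : ℕ} {S : Set ℕ} {p : Fin n → ℤ} (hp : Function.Injective p) :
    Ascends S p ↔ ∀ i ∈ descents p, 0 < i → i < n → i ∈ S := by
  constructor
  · intro h i hi h0 hn
    obtain ⟨j, rfl⟩ : ∃ j, i = j + 1 := ⟨i - 1, by omega⟩
    by_contra hS
    exact lt_asymm (h j hn hS) ((succ_mem_descents hn).mp hi)
  · intro h i hi hS
    have h1 : ¬ p ⟨i + 1, hi⟩ < p ⟨i, by omega⟩ := fun h2 =>
      hS (h _ ((succ_mem_descents hi).mpr h2) (by omega) hi)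
    refine lt_of_le_of_ne (not_lt.mp h1) fun h3 => ?_
    have := congrArg Fin.val (hp h3)
    simp at this

lemma ascends_perm {n : ℕ} {S : Set ℕ} {τ : Equiv.Perm (Fin n)} :
    Ascends S τ ↔ ∀ i ∈ desSet τ, 0 < i → i < n → i ∈ S := by
  rw [desSet_eq_descents, ← ascends_iff_descents (labels_injective τ)]
  exact forall₃_congr fun i hi _ => by simp [labels]

/-- The generating function of words with letters in the lexicographic product of
`{0, …, N - 1}` and a set of decorations, where the decorations have weight `1`. -/
def decoratedSum {B Γ : Type*} [Fintype B] [LinearOrder Γ] (κ : B → ℤ → Γ) (N : ℕ) {n : ℕ}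
    (S : Set ℕ) (p : Fin n → ℤ) : MvPowerSeries ℕ ℚ :=
  wordSum (fun (a : Fin N × B) (t : ℤ) => toLex (a.1, κ a.2 t))
    (fun a => MvPowerSeries.X (a.1 : ℕ)) S p

/-- The product of the functions attached by `f` to the consecutive segments, of lengths given by
a list, of a composition with set of partial sums `T`. -/
def blockProd (f : ∀ n, Composition n → QSym) : List ℕ → Finset ℕ → QSym
  | [], _ => 1
  | b :: L, T => f b (co b T) * blockProd f L (shiftSet b T)

lemma blockProd_congr (f : ∀ n, Composition n → QSym) {L : List ℕ} {T T' : Finset ℕ}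
    (h : ∀ i, 0 < i → i < L.sum → (i ∈ T ↔ i ∈ T')) : blockProd f L T = blockProd f L T' := by
  induction L generalizing T T' with
  | nil => rfl
  | cons b L ih =>
    rw [List.sum_cons] at h
    rw [blockProd, blockProd, co_congr fun i h0 hi => h i h0 (by omega), ih]
    intro i h0 hi
    simp only [mem_shiftSet]
    exact h _ (by omega) (by omega)

section

variable {B Γ : Type*} [Fintype B] [LinearOrder Γ] {κ : B → ℤ → Γ}
  {f : ∀ n, Composition n → QSym}

lemma agreeBelow_blockProd
    (hf : ∀ (n N : ℕ) (p : Fin n → ℤ), Function.Injective p →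
      AgreeBelow N (f n (co n (descents p))) (decoratedSum κ N ∅ p))
    (N : ℕ) (L : List ℕ) (p : Fin L.sum → ℤ) (hp : Function.Injective p) :
    AgreeBelow N (blockProd f L (descents p)) (decoratedSum κ N (listSums L) p) := by
  induction L with
  | nil =>
    intro m _
    have h : decoratedSum κ N (listSums []) p = 1 := wordSum_zero (listSums []) p
    rw [h]
    rfl
  | cons b L ih =>
    suffices key : ∀ p : Fin (b + L.sum) → ℤ, Function.Injective p →
        AgreeBelow N (f b (co b (descents p)) * blockProd f L (shiftSet b (descents p)) : QSym)
          (decoratedSum κ N (listSums (b :: L)) p) from key p hp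
    clear hp p
    intro p hp
    have h1 : decoratedSum κ N (listSums (b :: L)) p =
        decoratedSum κ N ∅ (fun i => p (Fin.castAdd L.sum i)) *
          decoratedSum κ N (listSums L) (fun i => p (Fin.natAdd b i)) := by
      refine (wordSum_add (S := listSums (b :: L)) ⟨1, by simp⟩ p).trans ?_
      congr 1
      · refine wordSum_congr (fun i hi => ?_) _
        simp only [Set.mem_empty_iff_false, iff_false, mem_listSums_cons]
        rintro (h | ⟨j, -, h⟩) <;> omega
      · exact wordSum_congr (fun i _ => add_mem_listSums_cons) _
    have h2 : co b (descents p) = co b (descents fun i => p (Fin.castAdd L.sum i)) := by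
      refine co_congr fun i h0 hi => ?_
      obtain ⟨j, rfl⟩ : ∃ j, i = j + 1 := ⟨i - 1, by omega⟩
      rw [succ_mem_descents (by omega), succ_mem_descents hi]
      rfl
    have h3 : blockProd f L (shiftSet b (descents p)) =
        blockProd f L (descents fun i => p (Fin.natAdd b i)) := by
      refine blockProd_congr f fun i h0 hi => ?_
      obtain ⟨j, rfl⟩ : ∃ j, i = j + 1 := ⟨i - 1, by omega⟩
      rw [mem_shiftSet, succ_mem_descents hi, show j + 1 + b = b + j + 1 by omega,
        succ_mem_descents (by omega)]
      rfl
    rw [h2, h3, h1]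
    exact AgreeBelow.mul (hf _ _ _ (hp.comp (Fin.castAdd_injective _ _)))
      (ih _ (hp.comp (Fin.natAdd_injective _ _)))

open Classical in
/-- The multiplication rule: the product over the segments of a word of labels is the sum over all
shuffles of these segments. It holds for any family of functions that are generating functions of
words with labels, whatever the decorations. -/
lemma blockProd_eq_sum (hκ : ∀ a b s t, κ a s = κ b t → s = t)
    (hf : ∀ (n N : ℕ) (p : Fin n → ℤ), Function.Injective p →
      AgreeBelow N (f n (co n (descents p))) (decoratedSum κ N ∅ p))
    (L : List ℕ) (p : Fin L.sum → ℤ) (hp : Function.Injective p) :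
    blockProd f L (descents p) =
      ∑ τ ∈ Finset.univ.filter fun τ : Equiv.Perm (Fin L.sum) => Ascends (listSums L) τ,
        f L.sum (co L.sum (descents fun i => p (τ⁻¹ i))) := by
  apply Subtype.ext
  refine eq_of_forall_agreeBelow fun N m hm => ?_
  rw [agreeBelow_blockProd hf N L p hp m hm, decoratedSum, wordSum_eq_sum_perm _ _ hp,
    AddSubmonoidClass.coe_finsetSum]
  · exact (AgreeBelow.sum fun τ _ => hf _ N _ (hp.comp τ⁻¹.injective)) m hm |>.symm
  · intro a b s t h
    exact hκ _ _ _ _ (Prod.mk.inj (toLex.injective h)).2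

end

open Classical in
lemma coef_F_D {n : ℕ} {L : List ℕ} (hL : ∀ a ∈ L, 0 < a) (τ : Equiv.Perm (Fin n)) :
    coef L (F (D τ)) = if L.sum = n ∧ Ascends (listSums L) τ then 1 else 0 := by
  rw [D, coef_F_co _ _ hL]
  exact if_congr (and_congr_right fun _ => ascends_perm.symm) rfl rfl

lemma agreeBelow_F (n N : ℕ) (p : Fin n → ℤ) (hp : Function.Injective p) :
    AgreeBelow N (F (co n (descents p))) (decoratedSum (fun (_ : Unit) t => t) N ∅ p) := by
  classical
  intro m hm
  rw [coeff_F_co, decoratedSum, coeff_wordSum_lex (fun (_ : Unit) t => t) p m hm, ite_and]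
  refine if_congr Iff.rfl ?_ rfl
  by_cases h : Ascends (listSums (expList m)) p
  · rw [if_pos ((ascends_iff_descents hp).mp h)]
    simp [h]
  · rw [if_neg ((ascends_iff_descents hp).not.mp h)]
    simp [h]

/-! ### Homogeneous components -/

lemma mem_QSymDeg_iff {n : ℕ} {f : QSym} :
    f ∈ QSymDeg n ↔
      ∀ m : ℕ →₀ ℕ, m.degree ≠ n → MvPowerSeries.coeff m (f : MvPowerSeries ℕ ℚ) = 0 := by
  constructor
  · intro hf m hm
    rw [coeff_eq_coef_expList]
    exact coef_eq_zero_of_mem hf (fun _ => expList_pos) (by rwa [expList_sum])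
  · intro h
    have : f = ∑ β : Composition n, coef β.blocks f • M β := by
      apply Subtype.ext
      ext m
      rw [coeff_sum_smul_M n (fun L => coef L f)]
      split_ifs with hm
      · rw [coeff_eq_coef_expList]
      · exact h m hm
    rw [this]
    exact Submodule.sum_mem _ fun β _ => Submodule.smul_mem _ _ (Submodule.subset_span ⟨β, rfl⟩)

lemma coef_whole (n : ℕ) (f : QSym) : coef (whole n).blocks f =
    MvPowerSeries.coeff (Finsupp.single 0 n) (f : MvPowerSeries ℕ ℚ) := by
  rw [coeff_eq_coef_expList, expList_single]

lemma coef_whole_mul {a b : ℕ} {f : QSym} (hf : f ∈ QSymDeg a) (g : QSym) :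
    coef (whole (a + b)).blocks (f * g) =
      coef (whole a).blocks f * coef (whole b).blocks g := by
  classical
  rw [coef_whole, coef_whole, coef_whole, Subalgebra.coe_mul, MvPowerSeries.coeff_mul,
    Finsupp.antidiagonal_single, Finset.sum_map, Finset.sum_eq_single (a, b)]
  · rfl
  · intro p hp hne
    have hp' := Finset.HasAntidiagonal.mem_antidiagonal.mp hp
    have h : p.1 ≠ a := by
      rintro rfl
      exact hne (Prod.ext rfl (by simp only; omega))
    have h2 := mem_QSymDeg_iff.mp hf (Finsupp.single 0 p.1) (by simpa using h)
    simp [h2]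
  · exact fun h => absurd (Finset.HasAntidiagonal.mem_antidiagonal (a := (a, b)).mpr rfl) h

/-! ### The action of an endomorphism on fundamental quasisymmetric functions -/

lemma listSums_whole {n i : ℕ} (h : i ∈ listSums (whole n).blocks) : i = 0 ∨ i = n := by
  rw [blocks_whole] at h
  split_ifs at h with hn
  · rcases mem_listSums_cons.mp h with h | ⟨j, ⟨k, hk⟩, rfl⟩
    · exact Or.inl h
    · right; simp at hk; omega
  · obtain ⟨k, hk⟩ := h
    left; simp at hk; omega

lemma partialSums_eq_empty_iff {n : ℕ} {α : Composition n} :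
    partialSums α = ∅ ↔ α = whole n := by
  have h : partialSums (whole n) = ∅ := by
    rw [Finset.eq_empty_iff_forall_notMem]
    intro i hi
    obtain ⟨h0, hn, h⟩ := mem_partialSums.mp hi
    rcases listSums_whole h with h | h <;> omega
  rw [← h]
  exact partialSums_injective.eq_iff

lemma coef_whole_F {n : ℕ} (α : Composition n) :
    coef (whole n).blocks (F α) = if α = whole n then 1 else 0 := by
  classical
  rw [coef_whole, coeff_F, Finsupp.degree_single, expList_single]
  refine if_congr ?_ rfl rfl
  rw [← partialSums_eq_empty_iff, Finset.eq_empty_iff_forall_notMem]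
  refine ⟨fun h i hi => ?_, fun h => ⟨rfl, fun i hi => absurd hi (h i)⟩⟩
  obtain ⟨h0, hn, -⟩ := mem_partialSums.mp hi
  rcases listSums_whole (h.2 i hi) with h | h <;> omega

lemma F_co_zero (T : Finset ℕ) : F (co 0 T) = 1 := by
  classical
  apply Subtype.ext
  ext m
  rw [coeff_F_co, Subalgebra.coe_one, MvPowerSeries.coeff_one]
  refine if_congr ?_ rfl rfl
  rw [Finsupp.degree_eq_zero_iff]
  exact ⟨fun h => h.1, fun h => ⟨h, fun i _ _ hi => by omega⟩⟩

variable (Φ : QSymEnd)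

lemma QSymEnd.lin_mul (f g : QSym) : Φ.lin (f * g) = Φ.lin f * Φ.lin g := map_mul Φ.toAlgHom f g

lemma QSymEnd.lin_mem {n : ℕ} {f : QSym} (hf : f ∈ QSymDeg n) : Φ.lin f ∈ QSymDeg n :=
  Φ.map_deg n f hf

lemma QSymEnd.c_whole {n : ℕ} (α : Composition n) :
    Φ.c α (whole n) = coef (whole n).blocks (Φ.lin (F α)) := by
  rw [Φ.c_spec, map_sum, Finset.sum_eq_single (whole n)]
  · rw [map_smul, coef_whole_F, if_pos rfl, smul_eq_mul, mul_one]
  · intro β _ h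
    rw [map_smul, coef_whole_F, if_neg h, smul_zero]
  · exact fun h => absurd (Finset.mem_univ _) h

/-- Since `Φ` is a coalgebra homomorphism, splitting off the first part of an exponent list
factors the coefficient. -/
lemma QSymEnd.coef_cons_lin_F {b n : ℕ} {L : List ℕ} (hb : 0 < b) (hL : ∀ a ∈ L, 0 < a)
    (T : Finset ℕ) :
    coef (b :: L) (Φ.lin (F (co (b + n) T))) =
      coef [b] (Φ.lin (F (co b T))) * coef L (Φ.lin (F (co n (shiftSet b T)))) := by
  have hb' : ∀ a ∈ [b], 0 < a := by simpa using hb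
  have h : comul (Φ.lin (F (co (b + n) T))) =
      TensorProduct.map Φ.lin Φ.lin (comul (F (co (b + n) T))) := Φ.map_comul _
  rw [← List.singleton_append, ← tensorFun_coef_comul hb' hL, h, comul_F_co, map_sum, map_sum,
    Finset.sum_eq_single b]
  · rw [TensorProduct.map_tmul, tensorFun_tmul, Nat.add_sub_cancel_left]
  · intro i _ hi
    rw [TensorProduct.map_tmul, tensorFun_tmul,
      coef_eq_zero_of_mem (Φ.lin_mem (F_mem _)) hb', zero_mul]
    simpa using hi.symm
  · exact fun h => absurd (Finset.mem_range.mpr (by omega)) h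

lemma QSymEnd.coef_lin_F {L : List ℕ} (hL : ∀ a ∈ L, 0 < a) (T : Finset ℕ) :
    coef L (Φ.lin (F (co L.sum T))) =
      coef (whole L.sum).blocks (Φ.lin (blockProd (fun _ α => F α) L T)) := by
  induction L generalizing T with
  | nil =>
    rw [List.sum_nil, F_co_zero, blockProd, blocks_whole, if_neg (lt_irrefl 0)]
  | cons b L ih =>
    have hb : 0 < b := hL b (by simp)
    have hL' : ∀ a ∈ L, 0 < a := fun a ha => hL a (by simp [ha])
    have hw : (whole b).blocks = [b] := by rw [blocks_whole, if_pos hb]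
    rw [List.sum_cons, Φ.coef_cons_lin_F hb hL', ih hL', blockProd, Φ.lin_mul,
      coef_whole_mul (Φ.lin_mem (F_mem _)), hw]

/-- The action of `Φ` on fundamental quasisymmetric functions, as a sum over the factorizations of
a permutation. -/
lemma QSymEnd.lin_F_D {n : ℕ} (π : Equiv.Perm (Fin n)) :
    Φ.lin (F (D π)) = ∑ τ : Equiv.Perm (Fin n), Φ.c (D (π * τ⁻¹)) (whole n) • F (D τ) := by
  classical
  refine ext_coef fun L hL => ?_
  by_cases hn : L.sum = n
  · subst hn
    have h1 : ∀ τ : Equiv.Perm (Fin L.sum), co L.sum (descents fun i => labels π (τ⁻¹ i)) =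
        D (π * τ⁻¹) := by
      intro τ
      rw [D, desSet_eq_descents]
      rfl
    rw [D, desSet_eq_descents, Φ.coef_lin_F hL,
      blockProd_eq_sum (fun _ _ _ _ h => h) agreeBelow_F L _ (labels_injective π), map_sum,
      map_sum, map_sum, Finset.sum_filter]
    refine Finset.sum_congr rfl fun τ _ => ?_
    rw [h1, ← Φ.c_whole, map_smul, coef_F_D hL, smul_eq_mul, mul_ite, mul_one, mul_zero]
    exact if_congr (by simp) rfl rfl
  · rw [coef_eq_zero_of_mem (Φ.lin_mem (F_mem _)) hL hn]
    refine (coef_eq_zero_of_mem (Submodule.sum_mem _ fun τ _ => ?_) hL hn).symm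
    exact Submodule.smul_mem _ _ (F_mem _)

lemma F_one (α : Composition 1) : F α = M (whole 1) := by
  have h : Subsingleton (Composition 1) :=
    Fintype.card_le_one_iff_subsingleton.mp (by rw [composition_card]; simp)
  rw [F, Finset.sum_filter, Fintype.sum_subsingleton _ (whole 1), if_pos]
  rw [Subsingleton.elim α (whole 1)]

lemma QSymEnd.coef_ones_lin_F (n : ℕ) (T : Finset ℕ) :
    coef (List.replicate n 1) (Φ.lin (F (co n T))) = Φ.lam ^ n := by
  induction n generalizing T with
  | zero =>
    have h := Φ.coef_lin_F (L := []) (by simp) T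
    rw [List.sum_nil] at h
    rw [List.replicate_zero, h, blockProd, pow_zero]
    have h1 : Φ.lin 1 = 1 := map_one Φ.toAlgHom
    rw [h1, coef_whole]
    simp
  | succ n ih =>
    rw [List.replicate_succ, add_comm n 1,
      Φ.coef_cons_lin_F one_pos fun a ha => by rw [List.eq_of_mem_replicate ha]; exact one_pos,
      ih, F_one, Φ.lam_spec, map_smul, coef_M (by simp), blocks_whole]
    simp [pow_add]

/-- The scalar `λ ^ n` is the sum of the numbers `c_{D(σ), n}`. -/
lemma QSymEnd.sum_c_D (n : ℕ) :
    ∑ σ : Equiv.Perm (Fin n), Φ.c (D σ) (whole n) = Φ.lam ^ n := by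
  classical
  have hL : ∀ a ∈ List.replicate n 1, 0 < a := fun a ha => by
    rw [List.eq_of_mem_replicate ha]; exact one_pos
  have h1 := congrArg (coef (List.replicate n 1)) (Φ.lin_F_D (1 : Equiv.Perm (Fin n)))
  rw [D, Φ.coef_ones_lin_F, map_sum] at h1
  rw [h1, ← Equiv.sum_comp (Equiv.inv (Equiv.Perm (Fin n)))]
  refine Finset.sum_congr rfl fun τ _ => ?_
  have h2 : Ascends (listSums (List.replicate n 1)) τ := by
    refine ascends_perm.mpr fun i _ _ hi => ?_
    exact ⟨i, by rw [List.take_replicate, List.sum_replicate, min_eq_left hi.le]; simp⟩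
  rw [map_smul, coef_F_D hL, if_pos ⟨by simp, h2⟩, smul_eq_mul, mul_one]
  rfl

/-! ### Lumping -/

lemma exists_descents_eq (n : ℕ) (T : Finset ℕ) :
    ∃ p : Fin n → ℤ, Function.Injective p ∧ ∀ i, 0 < i → i < n → (i ∈ descents p ↔ i ∈ T) := by
  -- Compare positions first by the number of elements of `T` up to them, in decreasing order.
  set d : ℕ → ℕ := fun j => ((Finset.range (j + 1)).filter (· ∈ T)).card with hd
  have hsucc : ∀ j, d (j + 1) = d j + if j + 1 ∈ T then 1 else 0 := by
    intro j
    simp only [hd]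
    rw [Finset.range_add_one (n := j + 1), Finset.filter_insert]
    split_ifs with h
    · rw [Finset.card_insert_of_notMem (by simp)]
    · rfl
  refine ⟨fun j => (j : ℕ) - (n : ℤ) * d j, fun i j h => ?_, fun i h0 hi => ?_⟩
  · have h1 := congrArg (· % (n : ℤ)) h
    simp only [Int.sub_mul_emod_self_left] at h1
    rw [Int.emod_eq_of_lt (by positivity) (by exact_mod_cast i.2),
      Int.emod_eq_of_lt (by positivity) (by exact_mod_cast j.2)] at h1
    exact Fin.ext (by exact_mod_cast h1)
  · obtain ⟨j, rfl⟩ : ∃ j, i = j + 1 := ⟨i - 1, by omega⟩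
    rw [succ_mem_descents hi]
    simp only [hsucc]
    split_ifs with h
    · simp only [h, iff_true]
      push_cast
      rw [mul_add]
      have : (j : ℤ) + 1 < n := by exact_mod_cast hi
      linarith
    · simp [h]

lemma D_surjective (n : ℕ) : Function.Surjective (D : Equiv.Perm (Fin n) → Composition n) := by
  intro α
  obtain ⟨p, hp, hT⟩ := exists_descents_eq n (partialSums α)
  obtain ⟨τ, hτ⟩ := exists_perm_strictMono hp
  refine ⟨τ, ?_⟩
  rw [← co_partialSums α, D, desSet_eq_descents]
  refine co_congr fun i h0 hi => ?_
  rw [← hT i h0 hi]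
  obtain ⟨j, rfl⟩ : ∃ j, i = j + 1 := ⟨i - 1, by omega⟩
  rw [succ_mem_descents hi, succ_mem_descents hi]
  have h3 := hτ.lt_iff_lt (a := τ ⟨j + 1, hi⟩) (b := τ ⟨j, by omega⟩)
  simpa [labels] using h3.symm

lemma isStochastic_iff {ι : Type*} [Fintype ι] {A : Matrix ι ι ℚ} :
    IsStochastic A ↔ (∀ i j, 0 ≤ A i j) ∧ ∀ i, ∑ j, A i j = 1 := by
  classical exact Matrix.mem_rowStochastic_iff_sum

lemma lumps_iff {ι κ : Type*} [Fintype ι] [DecidableEq κ] {A : Matrix ι ι ℚ} {f : ι → κ}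
    {B : Matrix κ κ ℚ} :
    Lumps A f B ↔ ∀ (x : ι) (b : κ), B (f x) b = ∑ z : ι with f z = b, A x z := by
  constructor
  · intro h x b
    convert h.entry x b
  · intro h
    have h' : ∀ (x : ι) (b : κ), B (f x) b =
        Finset.sum (@Finset.filter _ (fun z => f z = b) (fun _ => Classical.propDecidable _)
          Finset.univ) fun z => A x z := by
      intro x b
      convert h x b
    exact ⟨fun b x y hxy => by rw [← h', ← h', hxy], h'⟩

section

variable {Φ : QSymEnd} {n : ℕ} {r : Setoid (Composition n)}

lemma HasPartition.phi_descentClass (h : HasPartition Φ n r) (π : Equiv.Perm (Fin n)) :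
    h.phi (descentClass r π) = Φ.lin (F (D π)) := rfl

lemma descentClass_surjective (r : Setoid (Composition n)) :
    Function.Surjective (descentClass r) :=
  Quotient.mk_surjective.comp (D_surjective n)

open Classical in
/-- Applying `Φ` to the formula for `Φ(F_{D(π)})` collects its terms by equivalence classes. -/
lemma HasPartition.d_descentClass (h : HasPartition Φ n r) (π : Equiv.Perm (Fin n))
    (b : Quotient r) :
    h.d (descentClass r π) b =
      ∑ τ : Equiv.Perm (Fin n) with descentClass r τ = b, Φ.c (D (π * τ⁻¹)) (whole n) := by
  have h1 : ∑ b, h.d (descentClass r π) b • h.phi b =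
      ∑ b, (∑ τ : Equiv.Perm (Fin n) with descentClass r τ = b,
        Φ.c (D (π * τ⁻¹)) (whole n)) • h.phi b := by
    rw [← h.d_spec, h.phi_descentClass, Φ.lin_F_D, map_sum,
      ← Finset.sum_fiberwise Finset.univ (descentClass r)]
    refine Finset.sum_congr rfl fun b _ => ?_
    rw [Finset.sum_smul]
    refine Finset.sum_congr rfl fun τ hτ => ?_
    rw [map_smul, ← h.phi_descentClass, (Finset.mem_filter.mp hτ).2]
  have h2 := (Fintype.linearIndependent_iffₛ (v := h.phi)).mp h.linInd _ _ h1
  exact h2 b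

lemma QSymEnd.K_apply (Φ : QSymEnd) (π τ : Equiv.Perm (Fin n)) :
    Φ.K n π τ = 1 / Φ.lam ^ n * Φ.c (D (π * τ⁻¹)) (whole n) := by
  rw [QSymEnd.K, Matrix.of_apply, QSymEnd.prob, Φ.sum_c_D, div_eq_mul_one_div, mul_comm]

open Classical in
lemma HasPartition.Khat_descentClass (h : HasPartition Φ n r) (π : Equiv.Perm (Fin n))
    (b : Quotient r) :
    h.Khat (descentClass r π) b =
      ∑ τ : Equiv.Perm (Fin n) with descentClass r τ = b, Φ.K n π τ := by
  simp only [HasPartition.Khat, Matrix.of_apply, h.d_descentClass, Finset.mul_sum, Φ.K_apply]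

/-- Nonnegative coefficients make the two matrices stochastic, and the second one lumps the
first. -/
theorem HasPartition.stochastic_and_lumps (h : HasPartition Φ n r)
    (h0 : ∀ α : Composition n, 0 ≤ Φ.c α (whole n))
    (h1 : ∃ α : Composition n, Φ.c α (whole n) ≠ 0) :
    0 < Φ.lam ^ n ∧ IsStochastic h.Khat ∧ IsStochastic (Φ.K n) ∧
      Lumps (Φ.K n) (descentClass r) h.Khat := by
  classical
  have hpos : 0 < Φ.lam ^ n := by
    obtain ⟨α, hα⟩ := h1
    obtain ⟨σ, rfl⟩ := D_surjective n α
    rw [← Φ.sum_c_D]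
    exact Finset.sum_pos' (fun σ _ => h0 _) ⟨σ, Finset.mem_univ _, lt_of_le_of_ne (h0 _) hα.symm⟩
  have hK : ∀ π τ, 0 ≤ Φ.K n π τ := fun π τ => by
    rw [Φ.K_apply]
    exact mul_nonneg (by positivity) (h0 _)
  have hsum : ∀ π, ∑ τ, Φ.K n π τ = 1 := by
    intro π
    simp only [Φ.K_apply]
    rw [← Finset.mul_sum, ← Equiv.sum_comp (Equiv.inv (Equiv.Perm (Fin n))),
      ← Equiv.sum_comp (Equiv.mulLeft π⁻¹)]
    simp only [Equiv.coe_mulLeft, Equiv.inv_apply, inv_inv, mul_inv_cancel_left]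
    rw [Φ.sum_c_D, one_div_mul_cancel hpos.ne']
  refine ⟨hpos, isStochastic_iff.mpr ?_, isStochastic_iff.mpr ⟨hK, hsum⟩,
    lumps_iff.mpr fun π b => h.Khat_descentClass π b⟩
  constructor
  · intro a b
    obtain ⟨π, rfl⟩ := descentClass_surjective r a
    rw [h.Khat_descentClass]
    exact Finset.sum_nonneg fun τ _ => hK π τ
  · intro a
    obtain ⟨π, rfl⟩ := descentClass_surjective r a
    simp only [h.Khat_descentClass]
    rw [Finset.sum_fiberwise Finset.univ (descentClass r), hsum]

end

/-! ### Peaks and signed words -/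

lemma mem_peaks {n : ℕ} {α : Composition n} {i : ℕ} :
    i ∈ peaks α ↔ i ∈ partialSums α ∧ i ≠ 1 ∧ i - 1 ∉ partialSums α := by
  simp [peaks]

lemma mem_peaks_co {n : ℕ} {T : Finset ℕ} {i : ℕ} :
    i ∈ peaks (co n T) ↔ 1 < i ∧ i < n ∧ i ∈ T ∧ i - 1 ∉ T := by
  rw [mem_peaks, mem_partialSums_co, mem_partialSums_co]
  constructor
  · rintro ⟨⟨h0, hn, hi⟩, h1, h2⟩
    exact ⟨by omega, hn, hi, fun h => h2 ⟨by omega, by omega, h⟩⟩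
  · rintro ⟨h1, hn, hi, h2⟩
    exact ⟨⟨by omega, hn, hi⟩, by omega, fun h => h2 h.2.2⟩

lemma one_lt_of_mem_peaks {n : ℕ} {α : Composition n} {i : ℕ} (h : i ∈ peaks α) :
    1 < i ∧ i < n := by
  rw [← co_partialSums α, mem_peaks_co] at h
  exact ⟨h.1, h.2.1⟩

lemma succ_notMem_peaks {n : ℕ} {α : Composition n} {i : ℕ} (h : i ∈ peaks α) :
    i + 1 ∉ peaks α := by
  intro h'
  exact (mem_peaks.mp h').2.2 (mem_peaks.mp h).1

lemma card_partialSums {n : ℕ} (hn : 0 < n) (α : Composition n) :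
    (partialSums α).card + 1 = α.length := by
  have h1 : (α.boundaries.image fun j : Fin (n + 1) => (j : ℕ)).card = α.length + 1 := by
    rw [Finset.card_image_of_injective _ Fin.val_injective,
      Composition.card_boundaries_eq_succ_length]
  have h2 : ({0, n} : Finset ℕ) ⊆ α.boundaries.image fun j : Fin (n + 1) => (j : ℕ) := by
    intro i hi
    rw [Finset.mem_image]
    rcases Finset.mem_insert.mp hi with rfl | hi
    · exact ⟨0, α.toCompositionAsSet.zero_mem, rfl⟩
    · exact ⟨Fin.last n, α.toCompositionAsSet.getLast_mem, (Finset.mem_singleton.mp hi).symm⟩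
  rw [partialSums, Finset.card_sdiff_of_subset h2, h1, Finset.card_pair (by omega)]
  have := α.length_pos_iff.mpr hn
  omega

/-- The key of a letter with sign `s` and label `t`: negative letters precede positive ones, the
labels of equal positive letters have to ascend, and those of equal negative letters to descend. -/
def signKey (s : Bool) (t : ℤ) : Bool ×ₗ ℤ := toLex (s, if s then t else -t)

lemma eq_of_signKey_eq {a b : Bool} {s t : ℤ} (h : signKey a s = signKey b t) : s = t := by
  obtain ⟨rfl, h2⟩ := Prod.mk.inj (toLex.injective h)
  cases a <;> simpa using h2

lemma signKey_lt_iff {a b : Bool} {s t : ℤ} (hst : s ≠ t) :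
    signKey a s < signKey b t ↔ (t < s → a = false) ∧ (¬ t < s → b = true) := by
  rw [signKey, signKey, Prod.Lex.toLex_lt_toLex]
  rcases lt_or_gt_of_ne hst with h | h <;> cases a <;> cases b <;> simp [h, h.not_gt]

lemma card_signs_of_imp {P Q : Prop} (h : P → ¬ Q) [Decidable (P ∨ Q)]
    [DecidablePred fun b : Bool => (P → b = false) ∧ (Q → b = true)] :
    (Finset.univ.filter fun b : Bool => (P → b = false) ∧ (Q → b = true)).card =
      if P ∨ Q then 1 else 2 := by
  by_cases hP : P
  · have hQ := h hP
    simp only [hP, hQ]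
    rfl
  · by_cases hQ : Q <;> simp only [hP, hQ] <;> rfl

open Classical in
/-- The number of ways to put signs on a word whose letters are constant exactly between the
partial sums of `β`: the sign of a letter is forced by a descent after it, or by an ascent before
it, inside its run of equal letters. The two requirements contradict each other at a peak, and
otherwise one sign per run stays free. -/
lemma card_signs {n : ℕ} {p : Fin n → ℤ} (hp : Function.Injective p) (β : Composition n) :
    (Finset.univ.filter fun s : Fin n → Bool =>
        Ascends (listSums β.blocks) fun i => signKey (s i) (p i)).card =
      if ∀ i ∈ peaks (co n (descents p)), i ∈ listSums β.blocks ∨ i - 1 ∈ listSums β.blocks then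
        2 ^ β.length else 0 := by
  set S := listSums β.blocks with hS
  set neg : ℕ → Prop := fun j => j + 1 < n ∧ j + 1 ∉ S ∧ j + 1 ∈ descents p with hneg
  set pos : ℕ → Prop := fun j => 0 < j ∧ j ∉ S ∧ j ∉ descents p with hpos
  have hA : ∀ s : Fin n → Bool, (Ascends S fun i => signKey (s i) (p i)) ↔
      ∀ j : Fin n, (neg j → s j = false) ∧ (pos j → s j = true) := by
    intro s
    have hne : ∀ i (hi : i + 1 < n), p ⟨i, by omega⟩ ≠ p ⟨i + 1, hi⟩ := by
      intro i hi h
      have := congrArg Fin.val (hp h)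
      simp at this
    constructor
    · intro h j
      constructor
      · rintro ⟨h1, h2, h3⟩
        exact ((signKey_lt_iff (hne _ h1)).mp (h j h1 h2)).1 ((succ_mem_descents h1).mp h3)
      · rintro ⟨h1, h2, h3⟩
        obtain ⟨j, hj⟩ := j
        obtain ⟨k, rfl⟩ : ∃ k, j = k + 1 := ⟨j - 1, by simp only at h1; omega⟩
        exact ((signKey_lt_iff (hne _ hj)).mp (h k hj h2)).2
          (fun h4 => h3 ((succ_mem_descents hj).mpr h4))
    · intro h i hi hiS
      rw [signKey_lt_iff (hne i hi), ← succ_mem_descents hi]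
      exact ⟨fun h1 => (h ⟨i, by omega⟩).1 ⟨hi, hiS, h1⟩,
        fun h1 => (h ⟨i + 1, hi⟩).2 ⟨Nat.succ_pos i, hiS, h1⟩⟩
  have hcard : (Finset.univ.filter fun s : Fin n → Bool =>
      Ascends S fun i => signKey (s i) (p i)) =
      Fintype.piFinset fun j : Fin n => Finset.univ.filter fun b : Bool =>
        (neg j → b = false) ∧ (pos j → b = true) := by
    ext s
    simp only [Finset.mem_filter, Finset.mem_univ, true_and, Fintype.mem_piFinset, hA]
  rw [hcard, Fintype.card_piFinset]
  split_ifs with h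
  · have hnot : ∀ j, neg j → ¬ pos j := by
      rintro j ⟨h1, h2, h3⟩ ⟨h4, h5, h6⟩
      have := h (j + 1) (mem_peaks_co.mpr ⟨by omega, h1, h3, by simpa using h6⟩)
      rw [Nat.add_sub_cancel] at this
      exact this.elim h2 h5
    have hcj : ∀ j : Fin n, (Finset.univ.filter fun b : Bool =>
        (neg j → b = false) ∧ (pos j → b = true)).card = if neg j ∨ pos j then 1 else 2 := by
      intro j
      exact card_signs_of_imp (hnot j)
    simp only [hcj]
    rw [Finset.prod_ite, Finset.prod_const_one, one_mul, Finset.prod_const]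
    congr 1
    rcases Nat.eq_zero_or_pos n with rfl | hn
    · have := β.length_eq_zero.mpr rfl
      simp [this]
    -- The forced positions are matched with the elements of `{1, …, n - 1}` outside `S`.
    have h1 : (Finset.univ.filter fun j : Fin n => neg j ∨ pos j).card =
        ((Finset.Ioo 0 n).filter (· ∉ S)).card := by
      have hd : Disjoint (Finset.univ.filter fun j : Fin n => neg j)
          (Finset.univ.filter fun j : Fin n => pos j) :=
        Finset.disjoint_filter.mpr fun j _ h1 => hnot j h1
      rw [Finset.filter_or, Finset.card_union_of_disjoint hd]
      rw [← Finset.card_filter_add_card_filter_not (s := (Finset.Ioo 0 n).filter (· ∉ S))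
        (· ∈ descents p)]
      congr 1
      · refine Finset.card_bij (fun j _ => (j : ℕ) + 1) ?_ ?_ ?_
        · intro j hj
          obtain ⟨h1, h2, h3⟩ := (Finset.mem_filter.mp hj).2
          simp [h1, h2, h3]
        · intro i _ j _ hij
          exact Fin.ext (by omega)
        · intro i hi
          simp only [Finset.mem_filter, Finset.mem_Ioo] at hi
          obtain ⟨⟨⟨h0, h1⟩, h2⟩, h3⟩ := hi
          have h4 : i - 1 + 1 = i := by omega
          exact ⟨⟨i - 1, by omega⟩, by simp [hneg, h1, h2, h3, h4], h4⟩
      · refine Finset.card_bij (fun j _ => (j : ℕ)) ?_ ?_ ?_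
        · intro j hj
          obtain ⟨h1, h2, h3⟩ := (Finset.mem_filter.mp hj).2
          simp [h1, h2, h3]
        · intro i _ j _ hij
          exact Fin.ext hij
        · intro i hi
          simp only [Finset.mem_filter, Finset.mem_Ioo] at hi
          obtain ⟨⟨⟨h0, h1⟩, h2⟩, h3⟩ := hi
          exact ⟨⟨i, h1⟩, by simp [hpos, h0, h2, h3], rfl⟩
    have h2 : (Finset.Ioo 0 n).filter (· ∈ S) = partialSums β := by
      ext i
      rw [mem_partialSums, Finset.mem_filter, Finset.mem_Ioo, and_assoc]
    have h3 := Finset.card_filter_add_card_filter_not (s := Finset.Ioo 0 n) (· ∈ S)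
    have h4 := Finset.card_filter_add_card_filter_not (s := (Finset.univ : Finset (Fin n)))
      (fun j => neg j ∨ pos j)
    have h5 := card_partialSums hn β
    rw [h2, Nat.card_Ioo] at h3
    rw [h1, Finset.card_univ, Fintype.card_fin] at h4
    omega
  · push Not at h
    obtain ⟨i, hi, h1, h2⟩ := h
    obtain ⟨h3, h4, h5, h6⟩ := mem_peaks_co.mp hi
    refine Finset.prod_eq_zero (Finset.mem_univ (⟨i - 1, by omega⟩ : Fin n)) ?_
    rw [Finset.card_eq_zero, Finset.filter_eq_empty_iff]
    intro b _ hb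
    have h7 : i - 1 + 1 = i := by omega
    have hb1 := hb.1 ⟨by simp only; omega, by simpa only [h7] using h1, by simpa only [h7] using h5⟩
    have hb2 := hb.2 ⟨by simp only; omega, h2, h6⟩
    simp [hb1] at hb2

/-! ### Stembridge's map -/

open Classical in
/-- The coefficient of `M_β` in the image of `F_α` under Stembridge's map, where `L` is the list of
parts of `β`. -/
def peakWeight {n : ℕ} (α : Composition n) (L : List ℕ) : ℚ :=
  if ∀ i ∈ peaks α, i ∈ listSums L ∨ i - 1 ∈ listSums L then 2 ^ L.length else 0

lemma peakWeight_eq_ite {n : ℕ} {α : Composition n} {L : List ℕ} {p : Prop} [Decidable p]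
    (h : (∀ i ∈ peaks α, i ∈ listSums L ∨ i - 1 ∈ listSums L) ↔ p) :
    peakWeight α L = if p then 2 ^ L.length else 0 := by
  classical
  exact if_congr h rfl rfl

/-- The peak function `∑ 2 ^ ℓ(β) M_β`, summed over all compositions `β` of `n` such that `S_β`
contains `i` or `i - 1` for every peak `i` of `α`. -/
def peakFun {n : ℕ} (α : Composition n) : QSym :=
  ∑ β : Composition n, peakWeight α β.blocks • M β

lemma coeff_peakFun {n : ℕ} (α : Composition n) (m : ℕ →₀ ℕ) :
    MvPowerSeries.coeff m (peakFun α : MvPowerSeries ℕ ℚ) =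
      if m.degree = n then peakWeight α (expList m) else 0 :=
  coeff_sum_smul_M n (peakWeight α) m

lemma coef_peakFun {n : ℕ} (α : Composition n) {L : List ℕ} (hL : ∀ a ∈ L, 0 < a) :
    coef L (peakFun α) = if L.sum = n then peakWeight α L else 0 := by
  rw [coef_apply, coeff_peakFun, degree_toFinsupp hL, expList_toFinsupp hL]

lemma peakFun_mem {n : ℕ} (α : Composition n) : peakFun α ∈ QSymDeg n :=
  Submodule.sum_mem _ fun β _ => Submodule.smul_mem _ _ (Submodule.subset_span ⟨β, rfl⟩)

lemma agreeBelow_peakFun (n N : ℕ) (p : Fin n → ℤ) (hp : Function.Injective p) :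
    AgreeBelow N (peakFun (co n (descents p))) (decoratedSum signKey N ∅ p) := by
  classical
  intro m hm
  rw [coeff_peakFun, decoratedSum, coeff_wordSum_lex signKey p m hm]
  split_ifs with h
  · have h1 := card_signs hp ⟨expList m, fun h => expList_pos h, (expList_sum m).trans h⟩
    simp only [Composition.length] at h1
    rw [h1, peakWeight]
    push_cast
    rfl
  · rfl

/-- Stembridge's map in degree `n`. -/
def peakMapDeg (n : ℕ) : QSymDeg n →ₗ[ℚ] QSym := (fBasis n).constr ℚ peakFun

/-- Stembridge's map: the linear map that sends each `F_α` to the peak function of `α`. -/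
def peakMap : QSym →ₗ[ℚ] QSym :=
  mBasis.constr ℚ fun α => peakMapDeg α.1 ⟨M α.2, Submodule.subset_span ⟨α.2, rfl⟩⟩

lemma peakMap_F {n : ℕ} (α : Composition n) : peakMap (F α) = peakFun α := by
  have h1 : ∀ β : Composition n,
      peakMap (M β) = peakMapDeg n ⟨M β, Submodule.subset_span ⟨β, rfl⟩⟩ := by
    intro β
    have h := mBasis.constr_basis ℚ (fun α : Σ n, Composition n =>
      peakMapDeg α.1 ⟨M α.2, Submodule.subset_span ⟨α.2, rfl⟩⟩) ⟨n, β⟩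
    rwa [mBasis_apply] at h
  have h2 : peakMap ∘ₗ (QSymDeg n).subtype = peakMapDeg n := by
    refine LinearMap.ext fun ⟨f, hf⟩ => ?_
    rw [LinearMap.comp_apply, Submodule.subtype_apply]
    induction hf using Submodule.span_induction with
    | mem x hx =>
      obtain ⟨β, rfl⟩ := hx
      exact h1 β
    | zero => rw [map_zero]; exact (map_zero (peakMapDeg n)).symm
    | add x y hx hy ihx ihy =>
      rw [map_add, ihx, ihy, ← map_add]
      rfl
    | smul a x hx ih =>
      rw [map_smul, ih, ← map_smul]
      rfl
  have h3 : (fBasis n α) = ⟨F α, F_mem α⟩ := Subtype.ext (fBasis_apply α)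
  have h4 := LinearMap.congr_fun h2 (fBasis n α)
  rw [peakMapDeg, Module.Basis.constr_basis, h3] at h4
  exact h4

lemma linearMap_ext_F {V : Type*} [AddCommMonoid V] [Module ℚ V] {φ ψ : QSym →ₗ[ℚ] V}
    (h : ∀ (n : ℕ) (T : Finset ℕ), φ (F (co n T)) = ψ (F (co n T))) : φ = ψ := by
  refine mBasis.ext fun ⟨n, α⟩ => ?_
  rw [mBasis_apply]
  refine LinearMap.eqOn_span ?_ (M_mem_span_F α)
  rintro _ ⟨β, rfl⟩
  rw [← co_partialSums β]
  exact h n _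

lemma peakMap_one : peakMap 1 = 1 := by
  classical
  rw [← F_co_zero ∅, peakMap_F]
  apply Subtype.ext
  ext m
  rw [coeff_peakFun, coeff_F_co]
  by_cases hm : m.degree = 0
  · have h1 : expList m = [] := by
      rw [(Finsupp.degree_eq_zero_iff m).mp hm]
      simp [expList]
    have h2 : ∀ i ∈ peaks (co 0 ∅), i ∈ listSums [] ∨ i - 1 ∈ listSums [] := fun i hi => by
      have := one_lt_of_mem_peaks hi
      omega
    rw [if_pos hm, h1, peakWeight, if_pos h2, if_pos ⟨hm, by simp⟩]
    simp
  · rw [if_neg hm, if_neg fun h => hm h.1]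

/-- Stembridge's map is multiplicative because products of fundamental quasisymmetric functions
and products of peak functions follow the same shuffle rule. -/
lemma peakMap_mul (f g : QSym) : peakMap (f * g) = peakMap f * peakMap g := by
  have key : ∀ (b c : ℕ) (T T' : Finset ℕ),
      peakMap (F (co b T) * F (co c T')) = peakMap (F (co b T)) * peakMap (F (co c T')) := by
    intro b c T T'
    obtain ⟨p, hp, hT⟩ := exists_descents_eq [b, c].sum
      (T.filter (· < b) ∪ (T'.filter (0 < ·)).image (b + ·))
    replace hT : ∀ i, 0 < i → i < b + c →
        (i ∈ descents p ↔ i ∈ T ∧ i < b ∨ ∃ j, (j ∈ T' ∧ 0 < j) ∧ b + j = i) :=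
      fun i h0 hi => (hT i h0 hi).trans (by simp)
    have h1 : co b T = co b (descents p) := by
      refine co_congr fun i h0 hi => ?_
      rw [hT i h0 (by omega)]
      constructor
      · exact fun h => Or.inl ⟨h, hi⟩
      · rintro (h | ⟨j, hj, rfl⟩)
        · exact h.1
        · omega
    have h2 : co c T' = co c (shiftSet b (descents p)) := by
      refine co_congr fun i h0 hi => ?_
      rw [mem_shiftSet, hT _ (by omega) (by omega)]
      constructor
      · exact fun h => Or.inr ⟨i, ⟨h, h0⟩, by omega⟩
      · rintro (h | ⟨j, hj, hji⟩)
        · omega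
        · rw [show i = j by omega]
          exact hj.1
    have h3 := blockProd_eq_sum (f := fun _ α => F α) (fun _ _ _ _ h => h) agreeBelow_F [b, c] p hp
    have h4 := blockProd_eq_sum (f := fun _ α => peakFun α) (fun _ _ _ _ => eq_of_signKey_eq)
      agreeBelow_peakFun [b, c] p hp
    simp only [blockProd, mul_one, ← h1, ← h2] at h3 h4
    rw [h3, map_sum, peakMap_F, peakMap_F, h4]
    exact Finset.sum_congr rfl fun τ _ => peakMap_F _
  have h1 : ∀ (b : ℕ) (T : Finset ℕ), peakMap ∘ₗ LinearMap.mulLeft ℚ (F (co b T)) =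
      LinearMap.mulLeft ℚ (peakMap (F (co b T))) ∘ₗ peakMap :=
    fun b T => linearMap_ext_F fun c T' => key b c T T'
  have h2 : peakMap ∘ₗ LinearMap.mulRight ℚ g = LinearMap.mulRight ℚ (peakMap g) ∘ₗ peakMap :=
    linearMap_ext_F fun b T => LinearMap.congr_fun (h1 b T) g
  exact LinearMap.congr_fun h2 f

lemma peakWeight_append {a b : ℕ} {L L' : List ℕ} (hL : L.sum = a) (hL' : L'.sum = b)
    (T : Finset ℕ) :
    peakWeight (co (a + b) T) (L ++ L') =
      peakWeight (co a T) L * peakWeight (co b (shiftSet a T)) L' := by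
  classical
  subst hL
  have h : (∀ i ∈ peaks (co (L.sum + b) T), i ∈ listSums (L ++ L') ∨ i - 1 ∈ listSums (L ++ L')) ↔
      (∀ i ∈ peaks (co L.sum T), i ∈ listSums L ∨ i - 1 ∈ listSums L) ∧
        ∀ i ∈ peaks (co b (shiftSet L.sum T)), i ∈ listSums L' ∨ i - 1 ∈ listSums L' := by
    constructor
    · intro h
      constructor
      · intro i hi
        obtain ⟨h1, h2, h3, h4⟩ := mem_peaks_co.mp hi
        have := h i (mem_peaks_co.mpr ⟨h1, by omega, h3, h4⟩)
        rwa [mem_listSums_append_of_le h2.le, mem_listSums_append_of_le (by omega)] at this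
      · intro i hi
        obtain ⟨h1, h2, h3, h4⟩ := mem_peaks_co.mp hi
        rw [mem_shiftSet, add_comm] at h3 h4
        have h5 : L.sum + i - 1 = L.sum + (i - 1) := by omega
        have := h (L.sum + i) (mem_peaks_co.mpr ⟨by omega, by omega, h3, by rwa [h5]⟩)
        rwa [h5, add_mem_listSums_append, add_mem_listSums_append] at this
    · rintro ⟨h, h'⟩ i hi
      obtain ⟨h1, h2, h3, h4⟩ := mem_peaks_co.mp hi
      rcases lt_or_ge i L.sum with h5 | h5
      · rw [mem_listSums_append_of_le h5.le, mem_listSums_append_of_le (by omega)]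
        exact h i (mem_peaks_co.mpr ⟨h1, h5, h3, h4⟩)
      obtain ⟨j, rfl⟩ := Nat.exists_eq_add_of_le h5
      by_cases hj0 : j = 0
      · subst hj0
        exact Or.inl (add_mem_listSums_append.mpr (zero_mem_listSums _))
      have h6 : L.sum + j - 1 = L.sum + (j - 1) := by omega
      rw [h6, add_mem_listSums_append, add_mem_listSums_append]
      by_cases hj1 : j = 1
      · subst hj1
        exact Or.inr (zero_mem_listSums _)
      · refine h' j (mem_peaks_co.mpr ⟨by omega, by omega, ?_, ?_⟩)
        · rwa [mem_shiftSet, add_comm]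
        · rwa [mem_shiftSet, add_comm, ← h6]
  simp only [peakWeight, h]
  rw [ite_and, List.length_append, pow_add]
  split_ifs <;> simp

lemma comul_peakMap (f : QSym) :
    comul (peakMap f) = TensorProduct.map peakMap peakMap (comul f) := by
  suffices h : comul ∘ₗ peakMap = TensorProduct.map peakMap peakMap ∘ₗ comul from
    LinearMap.congr_fun h f
  refine linearMap_ext_F fun n T => ext_tensorFun_coef fun L L' hL hL' => ?_
  have hLL : ∀ a ∈ L ++ L', 0 < a := fun a ha =>
    (List.mem_append.mp ha).elim (hL a) (hL' a)
  rw [LinearMap.comp_apply, LinearMap.comp_apply, tensorFun_coef_comul hL hL', comul_F_co,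
    map_sum, map_sum, peakMap_F, coef_peakFun _ hLL, List.sum_append]
  simp only [TensorProduct.map_tmul, tensorFun_tmul, peakMap_F, coef_peakFun _ hL,
    coef_peakFun _ hL']
  by_cases hn : L.sum + L'.sum = n
  · subst hn
    rw [if_pos rfl, Finset.sum_eq_single L.sum]
    · rw [if_pos rfl, Nat.add_sub_cancel_left, if_pos rfl, peakWeight_append rfl rfl]
    · exact fun i _ hi => by rw [if_neg hi.symm, zero_mul]
    · exact fun h => absurd (Finset.mem_range.mpr (by omega)) h
  · rw [if_neg hn]
    refine (Finset.sum_eq_zero fun i hi => ?_).symm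
    by_cases h1 : L.sum = i
    · rw [if_neg (c := L'.sum = n - i), mul_zero]
      have := Finset.mem_range.mp hi
      omega
    · rw [if_neg h1, zero_mul]

lemma peakMap_mem {n : ℕ} {f : QSym} (hf : f ∈ QSymDeg n) : peakMap f ∈ QSymDeg n := by
  rw [← span_F] at hf
  induction hf using Submodule.span_induction with
  | mem x hx =>
    obtain ⟨α, rfl⟩ := hx
    rw [peakMap_F]
    exact peakFun_mem α
  | zero => rw [map_zero]; exact Submodule.zero_mem _
  | add x y _ _ hx hy => rw [map_add]; exact Submodule.add_mem _ hx hy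
  | smul a x _ hx => rw [map_smul]; exact Submodule.smul_mem _ a hx

lemma counit_peakMap (f : QSym) : counit (peakMap f) = counit f := by
  suffices h : counit ∘ₗ peakMap = counit from LinearMap.congr_fun h f
  refine linearMap_ext_F fun n T => ?_
  rw [LinearMap.comp_apply]
  rcases Nat.eq_zero_or_pos n with rfl | hn
  · rw [F_co_zero, peakMap_one]
  · have h0 : ∀ g ∈ QSymDeg n, counit g = 0 := fun g hg =>
      mem_QSymDeg_iff.mp hg 0 (by simpa using hn.ne)
    rw [h0 _ (F_mem _), h0 _ (peakMap_mem (F_mem _))]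

/-- Stembridge's map as an endomorphism of the graded Hopf algebra of quasisymmetric functions. -/
def stembridge : QSymEnd where
  toAlgHom := AlgHom.ofLinearMap peakMap peakMap_one peakMap_mul
  map_comul := comul_peakMap
  map_counit := counit_peakMap
  map_deg _ _ hf := peakMap_mem hf

lemma stembridge_lin_F {n : ℕ} (α : Composition n) : stembridge.lin (F α) = peakFun α :=
  peakMap_F α

/-! ### Expansion of peak functions in the fundamental basis -/

lemma mem_symmDiff_image_succ {T : Finset ℕ} {i : ℕ} (hi : 0 < i) :
    i ∈ symmDiff T (T.image (· + 1)) ↔ ¬ (i ∈ T ↔ i - 1 ∈ T) := by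
  have h : i ∈ T.image (· + 1) ↔ i - 1 ∈ T := by
    rw [Finset.mem_image]
    exact ⟨fun ⟨t, ht, h⟩ => by rwa [← h, Nat.add_sub_cancel], fun h => ⟨_, h, by omega⟩⟩
  rw [Finset.mem_symmDiff, h]
  tauto

lemma mem_symmDiff_singleton {T : Finset ℕ} {x i : ℕ} :
    i ∈ symmDiff T {x} ↔ ¬ (i ∈ T ↔ i = x) := by
  rw [Finset.mem_symmDiff, Finset.mem_singleton]
  tauto

/-- The subsets of `S` that contain exactly one element of each of the disjoint pairs
`{i - 1, i}` with `i ∈ A`, provided that `S` meets all these pairs: adding or removing an element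
of one pair that lies in `S` shows that each pair halves their number. -/
lemma card_exactly_one {S A : Finset ℕ} (hA : ∀ i ∈ A, 0 < i ∧ i + 1 ∉ A)
    (hS : ∀ i ∈ A, i ∈ S ∨ i - 1 ∈ S) :
    2 ^ A.card * (S.powerset.filter fun T => ∀ i ∈ A, ¬ (i ∈ T ↔ i - 1 ∈ T)).card =
      2 ^ S.card := by
  induction A using Finset.induction_on with
  | empty => simp
  | insert j A hj ih =>
    have hA' : ∀ i ∈ A, 0 < i ∧ i + 1 ∉ A := fun i hi =>
      ⟨(hA i (Finset.mem_insert_of_mem hi)).1, fun h =>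
        (hA i (Finset.mem_insert_of_mem hi)).2 (Finset.mem_insert_of_mem h)⟩
    have hj0 := (hA j (Finset.mem_insert_self _ _)).1
    obtain ⟨x, hxS, hx⟩ : ∃ x ∈ S, x = j ∨ x = j - 1 :=
      (hS j (Finset.mem_insert_self _ _)).elim (fun h => ⟨j, h, Or.inl rfl⟩)
        fun h => ⟨j - 1, h, Or.inr rfl⟩
    have hne : ∀ i ∈ A, i ≠ x ∧ i - 1 ≠ x := by
      intro i hi
      have h1 : i ≠ j := fun h => hj (h ▸ hi)
      have h2 : i + 1 ≠ j := fun h =>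
        (hA i (Finset.mem_insert_of_mem hi)).2 (h ▸ Finset.mem_insert_self _ _)
      have h3 : i ≠ j + 1 := fun h =>
        (hA j (Finset.mem_insert_self _ _)).2 (Finset.mem_insert_of_mem (h ▸ hi))
      have h4 := (hA' i hi).1
      omega
    have hflip : ∀ T : Finset ℕ, (∀ i ∈ A, ¬ (i ∈ symmDiff T {x} ↔ i - 1 ∈ symmDiff T {x})) ↔
        ∀ i ∈ A, ¬ (i ∈ T ↔ i - 1 ∈ T) := by
      intro T
      refine forall₂_congr fun i hi => ?_
      rw [mem_symmDiff_singleton, mem_symmDiff_singleton]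
      have := hne i hi
      tauto
    have hflipj : ∀ T : Finset ℕ, (j ∈ symmDiff T {x} ↔ j - 1 ∈ symmDiff T {x}) ↔
        ¬ (j ∈ T ↔ j - 1 ∈ T) := by
      intro T
      rw [mem_symmDiff_singleton, mem_symmDiff_singleton]
      have h5 : j ≠ j - 1 := by omega
      rcases hx with rfl | rfl
      · have := h5.symm
        tauto
      · tauto
    have hsub : ∀ T ⊆ S, symmDiff T {x} ⊆ S := by
      intro T hT i hi
      rw [Finset.mem_symmDiff, Finset.mem_singleton] at hi
      rcases hi with hi | hi
      · exact hT hi.1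
      · exact hi.1 ▸ hxS
    have hhalf := Finset.card_filter_add_card_filter_not
      (s := S.powerset.filter fun T => ∀ i ∈ A, ¬ (i ∈ T ↔ i - 1 ∈ T))
      (fun T => ¬ (j ∈ T ↔ j - 1 ∈ T))
    have hbij : ((S.powerset.filter fun T => ∀ i ∈ A, ¬ (i ∈ T ↔ i - 1 ∈ T)).filter
        fun T => ¬ ¬ (j ∈ T ↔ j - 1 ∈ T)).card =
        ((S.powerset.filter fun T => ∀ i ∈ A, ¬ (i ∈ T ↔ i - 1 ∈ T)).filter
        fun T => ¬ (j ∈ T ↔ j - 1 ∈ T)).card := by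
      refine Finset.card_bij' (fun T _ => symmDiff T {x}) (fun T _ => symmDiff T {x}) ?_ ?_ ?_ ?_
      · intro T hT
        simp only [Finset.mem_filter, Finset.mem_powerset] at hT ⊢
        exact ⟨⟨hsub T hT.1.1, (hflip T).mpr hT.1.2⟩, fun h => hT.2 ((hflipj T).mp h)⟩
      · intro T hT
        simp only [Finset.mem_filter, Finset.mem_powerset] at hT ⊢
        exact ⟨⟨hsub T hT.1.1, (hflip T).mpr hT.1.2⟩, fun h => h ((hflipj T).mpr hT.2)⟩
      · intro T _
        exact symmDiff_symmDiff_cancel_right _ _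
      · intro T _
        exact symmDiff_symmDiff_cancel_right _ _
    have hfilter : (S.powerset.filter fun T => ∀ i ∈ insert j A, ¬ (i ∈ T ↔ i - 1 ∈ T)) =
        (S.powerset.filter fun T => ∀ i ∈ A, ¬ (i ∈ T ↔ i - 1 ∈ T)).filter
          fun T => ¬ (j ∈ T ↔ j - 1 ∈ T) := by
      ext T
      simp only [Finset.mem_filter, Finset.forall_mem_insert]
      tauto
    have ih' := ih hA' fun i hi => hS i (Finset.mem_insert_of_mem hi)
    rw [hfilter, Finset.card_insert_of_notMem hj, ← ih', ← hhalf, hbij]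
    ring

lemma peakWeight_blocks {n : ℕ} (hn : 0 < n) (α γ : Composition n) :
    peakWeight α γ.blocks = 2 ^ ((peaks α).card + 1) *
      ((Finset.univ.filter fun β : Composition n =>
        peaks α ⊆ symmDiff (partialSums β) ((partialSums β).image (· + 1)) ∧
          partialSums β ⊆ partialSums γ).card : ℚ) := by
  have hcard : (Finset.univ.filter fun β : Composition n =>
        peaks α ⊆ symmDiff (partialSums β) ((partialSums β).image (· + 1)) ∧
          partialSums β ⊆ partialSums γ).card =
      ((partialSums γ).powerset.filter fun T => ∀ i ∈ peaks α, ¬ (i ∈ T ↔ i - 1 ∈ T)).card := by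
    have hiff : ∀ T : Finset ℕ, peaks α ⊆ symmDiff T (T.image (· + 1)) ↔
        ∀ i ∈ peaks α, ¬ (i ∈ T ↔ i - 1 ∈ T) := fun T =>
      forall₂_congr fun i hi =>
        mem_symmDiff_image_succ (zero_lt_one.trans (one_lt_of_mem_peaks hi).1)
    refine Finset.card_bij (fun β _ => partialSums β) ?_ ?_ ?_
    · intro β hβ
      simp only [Finset.mem_filter, Finset.mem_univ, true_and, Finset.mem_powerset] at hβ ⊢
      exact ⟨hβ.2, (hiff _).mp hβ.1⟩
    · exact fun β _ β' _ h => partialSums_injective h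
    · intro T hT
      simp only [Finset.mem_filter, Finset.mem_powerset] at hT
      have h1 : partialSums (co n T) = T := partialSums_co fun i hi =>
        have h2 := mem_partialSums.mp (hT.1 hi)
        ⟨h2.1, h2.2.1⟩
      refine ⟨co n T, ?_, h1⟩
      simp only [Finset.mem_filter, Finset.mem_univ, true_and, h1]
      exact ⟨(hiff T).mpr hT.2, hT.1⟩
  rw [hcard, peakWeight]
  have hmem : ∀ i ∈ peaks α, (i ∈ listSums γ.blocks ∨ i - 1 ∈ listSums γ.blocks ↔
      i ∈ partialSums γ ∨ i - 1 ∈ partialSums γ) := by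
    intro i hi
    have h1 := one_lt_of_mem_peaks hi
    rw [mem_partialSums, mem_partialSums]
    have h2 : 0 < i := by omega
    have h3 : 0 < i - 1 := by omega
    have h4 : i - 1 < n := by omega
    simp only [h1.2, h2, h3, h4, true_and]
  split_ifs with h
  · have h1 := card_exactly_one (S := partialSums γ) (A := peaks α)
      (fun i hi => ⟨zero_lt_one.trans (one_lt_of_mem_peaks hi).1, succ_notMem_peaks hi⟩)
      fun i hi => (hmem i hi).mp (h i hi)
    rw [γ.blocks_length, ← card_partialSums hn γ, pow_succ, pow_succ, mul_right_comm]
    congr 1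
    exact_mod_cast h1.symm
  · refine (mul_eq_zero_of_right _ (Nat.cast_eq_zero.mpr (Finset.card_eq_zero.mpr ?_))).symm
    rw [Finset.filter_eq_empty_iff]
    intro T hT h1
    refine h fun i hi => (hmem i hi).mpr ?_
    have h2 := h1 i hi
    have h3 := Finset.mem_powerset.mp hT
    by_cases h4 : i ∈ T
    · exact Or.inl (h3 h4)
    · refine Or.inr (h3 ?_)
      by_contra h5
      exact h2 ⟨fun h => absurd h h4, fun h => absurd h h5⟩

lemma isStembridge_stembridge : IsStembridge stembridge := by
  classical
  intro n hn α
  rw [stembridge_lin_F]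
  apply ext_coef
  intro L hL
  rw [coef_peakFun _ hL, map_smul, map_sum]
  by_cases hLn : L.sum = n
  · set γ : Composition n := ⟨L, fun h => hL _ h, hLn⟩ with hγ
    have hco : ∀ β : Composition n, coef L (F β) =
        if partialSums β ⊆ partialSums γ then 1 else 0 := by
      intro β
      rw [← co_partialSums β, coef_F_co _ _ hL, co_partialSums]
      refine if_congr ?_ rfl rfl
      constructor
      · rintro ⟨-, h⟩ i hi
        have h1 := mem_partialSums.mp hi
        exact mem_partialSums.mpr ⟨h1.1, h1.2.1, h i hi h1.1 h1.2.1⟩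
      · exact fun h => ⟨hLn, fun i hi _ _ => (mem_partialSums.mp (h hi)).2.2⟩
    have hw := peakWeight_blocks hn α γ
    rw [if_pos hLn]
    simp only [hco]
    rw [Finset.sum_boole, Finset.filter_filter, smul_eq_mul]
    convert hw using 4
  · rw [if_neg hLn, Finset.sum_eq_zero, smul_zero]
    exact fun β _ => coef_eq_zero_of_mem (F_mem β) hL hLn

/-! ### The partition by peaks -/

lemma linearIndependent_of_triangular {ι V : Type*} [Fintype ι] [AddCommGroup V] [Module ℚ V]
    (v : ι → V) (φ : ι → V →ₗ[ℚ] ℚ) (w : ι → ℕ) (h1 : ∀ i, φ i (v i) ≠ 0)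
    (h2 : ∀ i j, i ≠ j → φ j (v i) ≠ 0 → w i < w j) : LinearIndependent ℚ v := by
  rw [Fintype.linearIndependent_iff]
  intro g hg i
  induction hi : w i using Nat.strong_induction_on generalizing i with
  | _ k ih =>
    have h3 := congrArg (φ i) hg
    rw [map_sum, map_zero, Finset.sum_eq_single i] at h3
    · rw [map_smul, smul_eq_mul] at h3
      exact (mul_eq_zero.mp h3).resolve_right (h1 i)
    · intro j _ hj
      rw [map_smul, smul_eq_mul]
      by_cases h4 : φ i (v j) = 0
      · rw [h4, mul_zero]
      · rw [ih (w j) (hi ▸ h2 j i hj h4) j rfl, zero_mul]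
    · exact fun h => absurd (Finset.mem_univ _) h

/-- If every element of a set `A` without two consecutive elements lies in `B` or has its
predecessor in `B`, then this correspondence injects `A` into `B`, so that `A` has the smaller
weight for weights that decrease along the integers. -/
lemma sum_lt_sum_of_forall_mem_or {n : ℕ} {A B : Finset ℕ} (hA : ∀ i ∈ A, i + 1 ∉ A)
    (hA' : ∀ i ∈ A, 0 < i) (hB : ∀ i ∈ B, i < n) (hne : A ≠ B)
    (h : ∀ i ∈ A, i ∈ B ∨ i - 1 ∈ B) : ∑ i ∈ A, (n - i) < ∑ i ∈ B, (n - i) := by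
  set g : ℕ → ℕ := fun i => if i ∈ B then i else i - 1 with hg
  have hgB : ∀ i ∈ A, g i ∈ B := by
    intro i hi
    simp only [hg]
    split_ifs with hiB
    · exact hiB
    · exact (h i hi).resolve_left hiB
  have hle : ∀ i, g i ≤ i := by
    intro i
    simp only [hg]
    split_ifs <;> omega
  have hinj : Set.InjOn g A := by
    intro i hi j hj hij
    have h1 := hA' i hi
    have h2 := hA' j hj
    have h3 : i + 1 ≠ j := fun h => hA i hi (h ▸ hj)
    have h4 : j + 1 ≠ i := fun h => hA j hj (h ▸ hi)
    simp only [hg] at hij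
    split_ifs at hij <;> omega
  have himage : ∑ i ∈ A, (n - g i) = ∑ i ∈ A.image g, (n - i) := (Finset.sum_image hinj).symm
  have hsub : A.image g ⊆ B := Finset.image_subset_iff.mpr hgB
  have h1 : ∑ i ∈ A, (n - i) ≤ ∑ i ∈ A, (n - g i) :=
    Finset.sum_le_sum fun i _ => Nat.sub_le_sub_left (hle i) n
  have h2 : ∑ i ∈ A.image g, (n - i) ≤ ∑ i ∈ B, (n - i) := Finset.sum_le_sum_of_subset hsub
  by_cases hAB : A ⊆ B
  · obtain ⟨j, hjB, hjA⟩ := Finset.exists_of_ssubset (Finset.ssubset_iff_subset_ne.mpr ⟨hAB, hne⟩)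
    exact Finset.sum_lt_sum_of_subset hAB hjB hjA (Nat.sub_pos_of_lt (hB j hjB))
      fun _ _ _ => zero_le
  · obtain ⟨i, hiA, hiB⟩ := Finset.not_subset.mp hAB
    have h3 : ∑ i ∈ A, (n - i) < ∑ i ∈ A, (n - g i) := by
      refine Finset.sum_lt_sum (fun i _ => Nat.sub_le_sub_left (hle i) n) ⟨i, hiA, ?_⟩
      have h4 := hA' i hiA
      have h5 := hB _ (hgB i hiA)
      simp only [hg, if_neg hiB] at h5 ⊢
      omega
    omega

lemma peakFun_congr {n : ℕ} {α β : Composition n} (h : peaks α = peaks β) :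
    peakFun α = peakFun β := by
  classical
  have h1 : peakWeight α = peakWeight β := by
    funext L
    exact peakWeight_eq_ite (by rw [h])
  simp only [peakFun, h1]

lemma coef_co_peaks_peakFun {n : ℕ} (α β : Composition n) :
    coef (co n (peaks β)).blocks (peakFun α) ≠ 0 ↔
      ∀ i ∈ peaks α, i ∈ peaks β ∨ i - 1 ∈ peaks β := by
  rw [coef_peakFun _ fun _ => (co n (peaks β)).blocks_pos, if_pos (co n (peaks β)).blocks_sum]
  have h : (∀ i ∈ peaks α, i ∈ listSums (co n (peaks β)).blocks ∨
      i - 1 ∈ listSums (co n (peaks β)).blocks) ↔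
      ∀ i ∈ peaks α, i ∈ peaks β ∨ i - 1 ∈ peaks β := by
    refine forall₂_congr fun i hi => ?_
    have h1 := one_lt_of_mem_peaks hi
    have hmem : ∀ j, 0 < j → j < n → (j ∈ listSums (co n (peaks β)).blocks ↔ j ∈ peaks β) := by
      intro j h0 hj
      have h2 := mem_partialSums (α := co n (peaks β)) (i := j)
      rw [mem_partialSums_co] at h2
      tauto
    rw [hmem i (by omega) h1.2, hmem (i - 1) (by omega) (by omega)]
  classical
  rw [peakWeight_eq_ite h]
  split_ifs with h'
  · exact iff_of_true (by positivity) h'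
  · exact iff_of_false (fun h => h rfl) h'

lemma hasPartition_stembridge (n : ℕ) : HasPartition stembridge n (peakSetoid n) := by
  have hconst : ∀ α β : Composition n, peakSetoid n α β →
      stembridge.lin (F α) = stembridge.lin (F β) := fun α β h => by
    rw [stembridge_lin_F, stembridge_lin_F, peakFun_congr h]
  refine ⟨hconst, ?_, ?_⟩
  · have hout : ∀ q : Quotient (peakSetoid n), Quotient.lift
        (fun α : Composition n => stembridge.lin (F α)) hconst q = peakFun q.out := by
      intro q
      conv_lhs => rw [← q.out_eq]
      exact stembridge_lin_F _
    refine linearIndependent_of_triangular _ (fun q => coef (co n (peaks q.out)).blocks)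
      (fun q => ∑ i ∈ peaks q.out, (n - i)) ?_ ?_
    · intro q
      rw [hout, coef_co_peaks_peakFun]
      exact fun i hi => Or.inl hi
    · intro q q' hne hq
      rw [hout, coef_co_peaks_peakFun] at hq
      refine sum_lt_sum_of_forall_mem_or (fun i => succ_notMem_peaks)
        (fun i hi => zero_lt_one.trans (one_lt_of_mem_peaks hi).1)
        (fun i hi => (one_lt_of_mem_peaks hi).2) (fun h => hne ?_) hq
      rw [← q.out_eq, ← q'.out_eq]
      exact Quotient.sound h
  · rw [← span_F, Submodule.map_span, ← Set.range_comp]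
    congr 1
    exact Set.range_quot_lift _

lemma stembridge_c_whole {n : ℕ} (hn : 0 < n) (α : Composition n) :
    stembridge.c α (whole n) = if peaks α = ∅ then 2 else 0 := by
  rw [stembridge.c_whole, stembridge_lin_F, coef_peakFun _ fun _ => (whole n).blocks_pos,
    if_pos (whole n).blocks_sum]
  have h : (∀ i ∈ peaks α, i ∈ listSums (whole n).blocks ∨ i - 1 ∈ listSums (whole n).blocks) ↔
      peaks α = ∅ := by
    rw [Finset.eq_empty_iff_forall_notMem]
    refine ⟨fun h i hi => ?_, fun h i hi => absurd hi (h i)⟩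
    have h1 := one_lt_of_mem_peaks hi
    rcases h i hi with h | h <;> rcases listSums_whole h with h | h <;> omega
  rw [peakWeight_eq_ite h, blocks_whole, if_pos hn]
  norm_num

lemma stembridge_lam : stembridge.lam = 2 := by
  have h := stembridge.coef_ones_lin_F 1 ∅
  have h1 : whole 1 = co 1 ∅ := by
    rw [← co_partialSums (whole 1)]
    exact co_congr fun i _ _ => by omega
  have h2 := stembridge_c_whole one_pos (co 1 ∅)
  rw [stembridge.c_whole, blocks_whole, if_pos one_pos, if_pos] at h2
  · rw [pow_one] at h
    exact h.symm.trans h2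
  · rw [Finset.eq_empty_iff_forall_notMem]
    intro i hi
    have := one_lt_of_mem_peaks hi
    omega

lemma stembridge_prob {n : ℕ} (hn : 0 < n) (π : Equiv.Perm (Fin n)) :
    stembridge.prob π = if peakSet π = ∅ then 1 / 2 ^ (n - 1) else 0 := by
  rw [QSymEnd.prob, stembridge.sum_c_D, stembridge_lam, stembridge_c_whole hn, peaks_D]
  split_ifs
  · obtain ⟨m, rfl⟩ : ∃ m, n = m + 1 := ⟨n - 1, by omega⟩
    rw [Nat.add_sub_cancel, pow_succ]
    field_simp
  · rw [zero_div]

lemma descentClass_eq_iff {n : ℕ} {π τ : Equiv.Perm (Fin n)} :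
    descentClass (peakSetoid n) π = descentClass (peakSetoid n) τ ↔ peakSet π = peakSet τ := by
  rw [← peaks_D, ← peaks_D]
  exact Quotient.eq

end QS

end

theorem theorem3p10 :
    (∀ (Φ : QSymEnd) (n : ℕ) (r : Setoid (Composition n)) (h : HasPartition Φ n r),
      (∀ α : Composition n, 0 ≤ Φ.c α (whole n)) →
      (∃ α : Composition n, Φ.c α (whole n) ≠ 0) →
        0 < Φ.lam ^ n ∧ IsStochastic h.Khat ∧ IsStochastic (Φ.K n) ∧
        Lumps (Φ.K n) (descentClass r) h.Khat) ∧
    (∃ Θ : QSymEnd, IsStembridge Θ ∧ ∀ n : ℕ, 0 < n →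
      (∀ α : Composition n, 0 ≤ Θ.c α (whole n)) ∧
      (∃ α : Composition n, Θ.c α (whole n) ≠ 0) ∧
      (∀ π : Equiv.Perm (Fin n), Θ.prob π = if peakSet π = ∅ then 1 / 2 ^ (n - 1) else 0) ∧
      ∃ h : HasPartition Θ n (peakSetoid n),
        IsStochastic h.Khat ∧ Lumps (Θ.K n) (descentClass (peakSetoid n)) h.Khat ∧
        ∀ π τ : Equiv.Perm (Fin n),
          h.Khat (descentClass (peakSetoid n) π) (descentClass (peakSetoid n) τ) =
            ∑ σ : Equiv.Perm (Fin n) with peakSet (σ⁻¹ * π) = peakSet τ, Θ.prob σ) := by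
  classical
  refine ⟨fun Φ n r h => h.stochastic_and_lumps, stembridge, isStembridge_stembridge,
    fun n hn => ?_⟩
  have h0 : ∀ α : Composition n, 0 ≤ stembridge.c α (whole n) := fun α => by
    rw [stembridge_c_whole hn]
    split_ifs <;> norm_num
  have h1 : ∃ α : Composition n, stembridge.c α (whole n) ≠ 0 := by
    refine ⟨co n ∅, ?_⟩
    rw [stembridge_c_whole hn, if_pos]
    · norm_num
    · rw [Finset.eq_empty_iff_forall_notMem]
      intro i hi
      simpa using (mem_peaks_co.mp hi).2.2.1
  have hP := hasPartition_stembridge n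
  obtain ⟨-, h2, -, h3⟩ := hP.stochastic_and_lumps h0 h1
  refine ⟨h0, h1, stembridge_prob hn, hP, h2, h3, fun π τ => ?_⟩
  rw [lumps_iff.mp h3, Finset.sum_filter, Finset.sum_filter,
    ← Equiv.sum_comp ((Equiv.inv (Equiv.Perm (Fin n))).trans (Equiv.mulRight π))]
  refine Finset.sum_congr rfl fun σ _ => ?_
  have h4 : ((Equiv.inv (Equiv.Perm (Fin n))).trans (Equiv.mulRight π)) σ = σ⁻¹ * π := rfl
  have h5 : stembridge.K n π (σ⁻¹ * π) = stembridge.prob σ := by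
    rw [QSymEnd.K_apply_mul, inv_inv]
  rw [h4, h5]
  exact if_congr descentClass_eq_iff rfl rfl
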